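/- Let $p$ be a prime and let $P\in\mathbb{Z}_p[x,y]$ satisfy $P(0,0)=0$ and $\frac{\partial P}{\partial y}(0,0)\not\equiv 0 \pmod p$. The Furstenberg series associated with $P$ is the unique $F=\sum_{n\ge 0}a(n)x^n\in\mathbb{Z}_p[[x]]$ with $F(0)=0$ and $P(x,F)=0$. For $\alpha\ge 1$, the minimal $p$-automaton generating $(a(n)\bmod p^\alpha)_{n\ge 0}$ is the smallest finite deterministic automaton with output, with input alphabet $\{0,1,\dots,p-1\}$, whose output after reading the standard base-$p$ representation of $n$, least significant digit first, is $a(n)\bmod p^\alpha$ for every $n\ge 0$, and whose output is not affected by leading zeros; its size is its number of states. Theorem. There is a function $\varepsilon(p,\alpha,h,d)$ such that $\varepsilon(p,\alpha,h,d)\to 0$ as any one of $p$ (through the primes), $\alpha$, $h$, $d$ tends to infinity while the other three remain constant, and such that the following holds. Let $p$ be a prime, let $\alpha\ge 1$, and let $F=\sum_{n\ge 0}a(n)x^n\in\mathbb{Z}_p[[x]]\setminus\{0\}$ be the Furstenberg series associated with a polynomial $P\in\mathbb{Z}_p[x,y]$ as above. Assume that $h=\deg_x P=\deg_x(P\bmod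 p)$ and $d=\deg_y P=\deg_y(P\bmod p)$. Then the minimal $p$-automaton generating $(a(n)\bmod p^\alpha)_{n\ge 0}$ exists, and its size is at most $$\bigl(1+\varepsilon(p,\alpha,h,d)\bigr)\,p^{\frac16\alpha(\alpha+1)\left((2hd-1)\alpha+hd+1\right)}.$$ -/

import Mathlib

open Filter Topology

/-- A deterministic automaton with output: input letters in `A`, states in `S`, outputs in `B`. -/
structure DFAO (A S B : Type*) where
  /-- transition function -/
  step : S → A → S
  /-- initial state -/
  start : S
  /-- output function on states -/
  out : S → B

/-- The output of the automaton after it has read the word `w`, first letter first. -/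
def DFAO.eval {A S B : Type*} (M : DFAO A S B) (w : List A) : B :=
  M.out (w.foldl M.step M.start)

/-- `M` generates the sequence `a`: its output on the standard base-`p` representation of `n`,
read with the least significant digit first, is `a n`.  (`Nat.digits p n` lists the digits with
the least significant first, and is the empty word for `n = 0`.) -/
def DFAO.Generates {p : ℕ} {S B : Type*} (M : DFAO (Fin p) S B) (a : ℕ → B) : Prop :=
  ∀ (n : ℕ) (w : List (Fin p)), w.map (fun i => (i : ℕ)) = Nat.digits p n → M.eval w = a n

/-- `M` is not affected by leading zeros.  As the least significant digit is read first, leading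
zeros stand at the end of the input word. -/
def DFAO.IgnoresLeadingZeros {p : ℕ} {S B : Type*} (M : DFAO (Fin p) S B) : Prop :=
  ∀ (w : List (Fin p)) (z : Fin p), (z : ℕ) = 0 → M.eval (w ++ [z]) = M.eval w

/-- `k` is the size (number of states) of the minimal `p`-automaton generating `a`: the least size
of a finite automaton that generates `a` and is not affected by leading zeros. -/
def IsMinimalAutomatonSize (p : ℕ) {B : Type*} (a : ℕ → B) (k : ℕ) : Prop :=
  IsLeast {m : ℕ | ∃ M : DFAO (Fin p) (Fin m) B, M.Generates a ∧ M.IgnoresLeadingZeros} k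

/-- `F` is the Furstenberg series associated with `P ∈ ℤ_p[x, y]` (`x` is the variable `0` and
`y` the variable `1`): `P(0, 0) = 0`, `∂P/∂y (0, 0)` is nonzero modulo `p`, `F(0) = 0` and
`P(x, F) = 0`. -/
structure IsFurstenbergSeries {p : ℕ} [Fact p.Prime] (P : MvPolynomial (Fin 2) ℤ_[p])
    (F : PowerSeries ℤ_[p]) : Prop where
  eval_zero : MvPolynomial.eval ![0, 0] P = 0
  pderiv_ne_zero :
    PadicInt.toZMod (MvPolynomial.eval ![0, 0] (MvPolynomial.pderiv 1 P)) ≠ 0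
  constantCoeff_eq_zero : PowerSeries.constantCoeff F = 0
  aeval_eq_zero : MvPolynomial.aeval ![PowerSeries.X, F] P = 0

/-! Work modulo `p ^ α` and put `q = p ^ (α - 1)`. Since `P ^ p` and `expand p P` agree modulo `p`,
the polynomial `B = P ^ q` satisfies `expand p B = B ^ p`. Reading a digit `i` on a fraction `S / B`
therefore acts on numerators by `S ↦ cartier p i (S * B ^ (p - 1))`. From Furstenberg's fraction `y
^ 2 * ∂P/∂y / P`, with denominator extended to `B`, reading `n` leads to a numerator whose
coefficient of `y ^ q` is a fixed unit times `a(n)` (`foldl_cartierStep_eq`). The states are the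
reachable numerators, and they have to be counted.

Writing `P ^ p = expand p P + p * R` shows that numerators keep the shape `∑ p ^ j * T j * P ^ (q -
1 - j)` (`cartier_mem_ladder`), where `T j` matters only modulo `p` (`card_ladder_le`). For `e = j +
1` the exponents of `T j` lie in `[0, h * e) × [1, d * e]` without the triangle of coordinate sum
below `e`, hence number at most `h d e² - e (e - 1) / 2`. The sum of this over `e ≤ α` is the
exponent in the theorem.

The initial numerator also meets the edge `x = h * e`. The first nonzero digit removes that edge for
good, so only the states reached by reading zeros remain. Their left, right and upper edges evolve
by one-variable Cartier maps (`face_cartierStep`), and two numerators with equal edges differ by an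
element of the ladder of the interior (`mem_ladder_of_face_eq_zero`), whose size bound is smaller by
the factor `p ^ ((h + d - 1) α (α + 1) / 2)`. The edges are eventually periodic
(`iterate_contract_eventually_periodic`), with a period subexponential in `h + d`
(`exists_dvd_X_pow_sub_X_pow`), so the zero path contributes only to `ε`. -/

open MvPolynomial in
/-- The two-variable Cartier operator: the coefficient of `x ^ i * y ^ j` in `cartier p r S` is
the coefficient of `x ^ (p * i + r) * y ^ (p * j)` in `S`. -/
noncomputable def cartier {A : Type*} [CommRing A] (p r : ℕ) [NeZero p] :
    MvPolynomial (Fin 2) A →ₗ[A] MvPolynomial (Fin 2) A :=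
  (basisMonomials (Fin 2) A).constr A fun m =>
    if p ∣ m 1 ∧ p ∣ m 0 - r ∧ r ≤ m 0 then
      monomial ((m - Finsupp.single 0 r).mapRange (· / p) (Nat.zero_div p)) 1 else 0

/-! ### Cartier operators on coefficients and supports. -/

section Cartier

open MvPolynomial

variable {A : Type*} [CommRing A] (p r : ℕ) [NeZero p]

lemma cartier_monomial (m : Fin 2 →₀ ℕ) (a : A) :
    cartier p r (monomial m a) = if p ∣ m 1 ∧ p ∣ m 0 - r ∧ r ≤ m 0 then
      monomial ((m - Finsupp.single 0 r).mapRange (· / p) (Nat.zero_div p)) a else 0 := by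
  have h : monomial m a = a • basisMonomials (Fin 2) A m := by
    rw [coe_basisMonomials, smul_monomial, smul_eq_mul, mul_one]
  rw [h, map_smul, cartier, Module.Basis.constr_basis]
  split_ifs
  · rw [smul_monomial, smul_eq_mul, mul_one]
  · rw [smul_zero]

lemma coeff_cartier (S : MvPolynomial (Fin 2) A) (m : Fin 2 →₀ ℕ) :
    (cartier p r S).coeff m = S.coeff (p • m + Finsupp.single 0 r) := by
  classical
  induction S using MvPolynomial.induction_on' with
  | add f g hf hg => rw [map_add, coeff_add, coeff_add, hf, hg]
  | monomial n a =>
    have hp : 0 < p := Nat.pos_of_ne_zero (NeZero.ne p)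
    rw [cartier_monomial, coeff_monomial]
    split_ifs with h1 h2 h2
    · obtain ⟨⟨b, hb⟩, ⟨c, hc⟩, h0⟩ := h1
      rw [coeff_monomial, if_pos]
      subst h2
      ext i
      fin_cases i <;> simp [hp]
    · obtain ⟨⟨b, hb⟩, ⟨c, hc⟩, h0⟩ := h1
      rw [coeff_monomial, if_neg]
      rintro rfl
      apply h2
      ext i
      fin_cases i
      · simp [hc, hp]; omega
      · simp [hb, hp]
    · subst h2
      simp at h1
    · simp

lemma cartier_expand_mul (hr : r < p) (G S : MvPolynomial (Fin 2) A) :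
    cartier p r (expand p G * S) = G * cartier p r S := by
  have hp : 0 < p := Nat.pos_of_ne_zero (NeZero.ne p)
  induction G using MvPolynomial.induction_on' with
  | add f g hf hg => rw [map_add, add_mul, add_mul, map_add, hf, hg]
  | monomial n a =>
    ext m
    rw [coeff_cartier, expand_monomial, coeff_monomial_mul', coeff_monomial_mul', coeff_cartier]
    by_cases h : n ≤ m
    · have h' : p • n ≤ p • m + Finsupp.single 0 r := fun i => by
        have := Nat.mul_le_mul_left p (h i)
        simp only [Finsupp.smul_apply, smul_eq_mul, Finsupp.add_apply]; omega
      rw [if_pos h, if_pos h']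
      congr 2
      obtain ⟨k, rfl⟩ := le_iff_exists_add.1 h
      rw [smul_add, add_assoc, add_tsub_cancel_left, add_tsub_cancel_left]
    · rw [if_neg h]
      split_ifs with h'
      · have : ¬ ∀ i, n i ≤ m i := h
        push Not at this
        obtain ⟨i, hi⟩ := this
        have h1 := h' i
        fin_cases i
        · simp at h1 hi
          have := Nat.mul_le_mul_left p (Nat.succ_le_of_lt hi)
          rw [Nat.mul_succ] at this
          omega
        · simp at h1 hi
          exact absurd (Nat.le_of_mul_le_mul_left h1 hp) (by omega)
      · rfl

variable {p r}

/-- Reading the digits of `w` one at a time with the Cartier operators amounts to a single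
extraction of coefficients. -/
lemma coeff_foldl_cartier {B : MvPolynomial (Fin 2) A} (hB : expand p B = B ^ p)
    (w : List (Fin p)) (S : MvPolynomial (Fin 2) A) (m : Fin 2 →₀ ℕ) :
    (w.foldl (fun S (i : Fin p) => cartier p i (S * B ^ (p - 1))) S).coeff m =
      (S * B ^ (p ^ w.length - 1)).coeff
        (p ^ w.length • m + Finsupp.single 0 (Nat.ofDigits p (w.map fun i : Fin p => (i : ℕ)))) := by
  have hp : 0 < p := Nat.pos_of_ne_zero (NeZero.ne p)
  induction w generalizing S with
  | nil => simp
  | cons i w ih =>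
    have hpw : 1 ≤ p ^ w.length := Nat.one_le_pow _ _ hp
    -- The power of `B` enters the operator as `B ^ (p * (p ^ t - 1))` with `t = w.length`, and `p *
    -- (p ^ t - 1) + (p - 1) = p ^ (t + 1) - 1`.
    have key : cartier p i (S * B ^ (p - 1)) * B ^ (p ^ w.length - 1) =
        cartier p i (S * B ^ (p ^ (i :: w).length - 1)) := by
      rw [mul_comm, ← cartier_expand_mul p i i.2, map_pow, hB, ← pow_mul, mul_left_comm, ← pow_add]
      congr 3
      rw [List.length_cons, pow_succ']
      zify [hpw, hp, Nat.mul_pos hp hpw]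
      ring
    rw [List.foldl_cons, ih, key, coeff_cartier]
    congr 1
    rw [List.length_cons, List.map_cons, Nat.ofDigits_cons, pow_succ', smul_add, mul_smul,
      add_assoc, Finsupp.smul_single, smul_eq_mul, ← Finsupp.single_add, add_comm (i : ℕ)]

lemma mul_mem_restrictSupport {s t u : Set (Fin 2 →₀ ℕ)} {f g : MvPolynomial (Fin 2) A}
    (hf : f ∈ restrictSupport A s) (hg : g ∈ restrictSupport A t)
    (h : ∀ a ∈ s, ∀ b ∈ t, a + b ∈ u) : f * g ∈ restrictSupport A u := by
  refine restrictSupport_mono A ?_ (restrictSupport_add (R := A) s t ▸ Submodule.mul_mem_mul hf hg)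
  exact Set.add_subset_iff.2 h

lemma mem_restrictSupport_of_coeff {s : Set (Fin 2 →₀ ℕ)} {f : MvPolynomial (Fin 2) A}
    (h : ∀ m, f.coeff m ≠ 0 → m ∈ s) : f ∈ restrictSupport A s :=
  (mem_restrictSupport_iff A).2 fun m hm => h m (mem_support_iff.1 hm)

lemma coeff_eq_zero_of_mem_restrictSupport {s : Set (Fin 2 →₀ ℕ)} {f : MvPolynomial (Fin 2) A}
    (h : f ∈ restrictSupport A s) {m : Fin 2 →₀ ℕ} (hm : m ∉ s) : f.coeff m = 0 := by
  by_contra h0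
  exact hm ((mem_restrictSupport_iff A).1 h (mem_support_iff.2 h0))

lemma cartier_mem_restrictSupport {s t : Set (Fin 2 →₀ ℕ)} {f : MvPolynomial (Fin 2) A}
    (hf : f ∈ restrictSupport A s) (h : ∀ m, p • m + Finsupp.single 0 r ∈ s → m ∈ t) :
    cartier p r f ∈ restrictSupport A t := by
  refine mem_restrictSupport_of_coeff fun m hm => h m ?_
  by_contra h0
  rw [coeff_cartier, coeff_eq_zero_of_mem_restrictSupport hf h0] at hm
  exact hm rfl

end Cartier

/-! ### Lifting congruences modulo `p` to equalities modulo `p ^ α`. -/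

section PrimePower

open MvPolynomial

variable {p α : ℕ}

lemma natCast_pow_eq_zero {R : Type*} [CommRing R] [Algebra (ZMod (p ^ α)) R] {k : ℕ} (h : α ≤ k) :
    (p : R) ^ k = 0 := by
  have h0 : (p : ZMod (p ^ α)) ^ α = 0 := by rw [← Nat.cast_pow, ZMod.natCast_self]
  have h1 : (p : R) ^ α = 0 := by
    have := congrArg (algebraMap (ZMod (p ^ α)) R) h0
    simpa using this
  rw [← Nat.sub_add_cancel h, pow_add, h1, mul_zero]

/-- The reduction homomorphism from `ℤ/p^α` to `ℤ/p`. -/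
noncomputable def redModP (hα : 1 ≤ α) : ZMod (p ^ α) →+* ZMod p :=
  ZMod.castHom (dvd_pow_self p (by omega)) (ZMod p)

lemma redModP_eq_zero_iff (hα : 1 ≤ α) [NeZero p] (a : ZMod (p ^ α)) :
    redModP hα a = 0 ↔ ∃ b : ZMod (p ^ α), a = p * b := by
  constructor
  · intro h
    obtain ⟨n, rfl⟩ : ∃ n : ℕ, a = n := ⟨a.val, by rw [ZMod.natCast_zmod_val]⟩
    rw [map_natCast, ZMod.natCast_eq_zero_iff] at h
    obtain ⟨k, rfl⟩ := h
    exact ⟨k, by push_cast; rfl⟩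
  · rintro ⟨b, rfl⟩
    rw [map_mul, map_natCast, ZMod.natCast_self, zero_mul]

/-- Each `p`-th power gains one factor `p` in a congruence, so `α - 1` of them turn a congruence
modulo `p` into an equality. -/
lemma pow_pow_eq_of_dvd_sub {R : Type*} [CommRing R] [Algebra (ZMod (p ^ α)) R] (hα : 1 ≤ α)
    {a b : R} (h : (p : R) ∣ a - b) : a ^ p ^ (α - 1) = b ^ p ^ (α - 1) := by
  have := dvd_sub_pow_of_dvd_sub h (α - 1)
  rw [Nat.sub_add_cancel hα, natCast_pow_eq_zero (α := α) le_rfl, zero_dvd_iff] at this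
  exact sub_eq_zero.1 this

lemma exists_eq_mul_of_map_eq_zero (hα : 1 ≤ α) [NeZero p]
    {f : MvPolynomial (Fin 2) (ZMod (p ^ α))} (h : map (redModP hα) f = 0)
    {s : Set (Fin 2 →₀ ℕ)} (hs : f ∈ restrictSupport _ s) :
    ∃ g ∈ restrictSupport (ZMod (p ^ α)) s, f = p * g := by
  have h1 (m) : ∃ b : ZMod (p ^ α), f.coeff m = p * b := by
    rw [← redModP_eq_zero_iff hα, ← coeff_map, h, coeff_zero]
  choose b hb using h1
  refine ⟨∑ m ∈ f.support, monomial m (b m), ?_, ?_⟩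
  · refine Submodule.sum_mem _ fun m hm => (monomial_mem_restrictSupport _).2 (Or.inl ?_)
    exact (mem_restrictSupport_iff _).1 hs hm
  · conv_lhs => rw [f.as_sum]
    rw [Finset.mul_sum]
    refine Finset.sum_congr rfl fun m _ => ?_
    rw [hb, ← map_natCast C, C_mul_monomial]

lemma expand_pow_eq [hp : Fact p.Prime] (hα : 1 ≤ α) (P : MvPolynomial (Fin 2) (ZMod (p ^ α))) :
    expand p (P ^ p ^ (α - 1)) = (P ^ p ^ (α - 1)) ^ p := by
  rw [map_pow, ← pow_mul, mul_comm, pow_mul]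
  refine pow_pow_eq_of_dvd_sub hα ?_
  obtain ⟨g, -, hg⟩ := exists_eq_mul_of_map_eq_zero hα (f := expand p P - P ^ p)
    (by rw [map_sub, map_pow, map_expand, expand_zmod, sub_self]) (s := Set.univ) (by simp)
  exact ⟨g, hg⟩

end PrimePower

/-! ### Supports of powers of `P`. -/

section Newton

open MvPolynomial

variable {A : Type*} [CommRing A]

/-- The exponents of the monomials that can occur in the `e`-th power of a polynomial of bidegree
at most `(h, d)` without constant term. -/
def newton (h d e : ℕ) : Set (Fin 2 →₀ ℕ) := {m | m 0 ≤ h * e ∧ m 1 ≤ d * e ∧ e ≤ m 0 + m 1}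

lemma pow_mem_newton {h d a : ℕ} {f : MvPolynomial (Fin 2) A}
    (hf : f ∈ restrictSupport A (newton h d a)) (n : ℕ) :
    f ^ n ∈ restrictSupport A (newton h d (a * n)) := by
  induction n with
  | zero =>
    rw [pow_zero, ← C_1, C_apply]
    exact (monomial_mem_restrictSupport _).2 (Or.inl (by simp [newton]))
  | succ n ih =>
    rw [pow_succ]
    refine mul_mem_restrictSupport ih hf fun u hu v hv => ?_
    simp only [newton, Set.mem_ofPred_eq, Finsupp.add_apply, mul_add, mul_one] at *
    omega

lemma mul_mem_newton {h d a b : ℕ} {f g : MvPolynomial (Fin 2) A}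
    (hf : f ∈ restrictSupport A (newton h d a)) (hg : g ∈ restrictSupport A (newton h d b)) :
    f * g ∈ restrictSupport A (newton h d (a + b)) := by
  refine mul_mem_restrictSupport hf hg fun u hu v hv => ?_
  simp only [newton, Set.mem_ofPred_eq, Finsupp.add_apply, mul_add] at *
  omega

lemma expand_mem_newton {h d a n : ℕ} {f : MvPolynomial (Fin 2) A}
    (hf : f ∈ restrictSupport A (newton h d a)) :
    expand n f ∈ restrictSupport A (newton h d (a * n)) := by
  classical
  refine (mem_restrictSupport_iff _).2 fun m hm => ?_
  obtain ⟨u, hu, rfl⟩ := Finset.mem_image.1 (support_expand_subset f hm)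
  have hu := (mem_restrictSupport_iff _).1 hf hu
  simp only [newton, Set.mem_ofPred_eq, Finsupp.smul_apply, smul_eq_mul] at *
  have h1 := Nat.mul_le_mul_left n hu.1
  have h2 := Nat.mul_le_mul_left n hu.2.1
  have h3 := Nat.mul_le_mul_left n hu.2.2
  refine ⟨?_, ?_, ?_⟩ <;> linarith

end Newton

/-! ### The ladder of numerators: stability and size. -/

section Ladder

open MvPolynomial Pointwise

variable {p α : ℕ}

/-- The polynomials `∑ p ^ j * T j * P ^ (p ^ (α - 1) - 1 - j)` over `j ≥ k`, where the exponents
of `T j` lie in `Z (j + 1)`. -/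
noncomputable def ladder (P : MvPolynomial (Fin 2) (ZMod (p ^ α))) (Z : ℕ → Set (Fin 2 →₀ ℕ))
    (k : ℕ) : Submodule (ZMod (p ^ α)) (MvPolynomial (Fin 2) (ZMod (p ^ α))) :=
  ⨆ j : {j // k ≤ j}, (restrictSupport (ZMod (p ^ α)) (Z (j + 1))).map
    (LinearMap.mulLeft (ZMod (p ^ α)) ((p : MvPolynomial (Fin 2) (ZMod (p ^ α))) ^ (j : ℕ) *
      P ^ (p ^ (α - 1) - 1 - j)))

variable {P : MvPolynomial (Fin 2) (ZMod (p ^ α))} {Z Z' : ℕ → Set (Fin 2 →₀ ℕ)} {k : ℕ}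

lemma mem_ladder_of_le {j : ℕ} (hj : k ≤ j) {T : MvPolynomial (Fin 2) (ZMod (p ^ α))}
    (hT : T ∈ restrictSupport (ZMod (p ^ α)) (Z (j + 1))) :
    (p : MvPolynomial (Fin 2) (ZMod (p ^ α))) ^ j * P ^ (p ^ (α - 1) - 1 - j) * T ∈ ladder P Z k :=
  Submodule.mem_iSup_of_mem (⟨j, hj⟩ : {j // k ≤ j}) ⟨T, hT, rfl⟩

lemma ladder_le {N : Submodule (ZMod (p ^ α)) (MvPolynomial (Fin 2) (ZMod (p ^ α)))}
    (h : ∀ j, k ≤ j → ∀ T ∈ restrictSupport (ZMod (p ^ α)) (Z (j + 1)),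
      (p : MvPolynomial (Fin 2) (ZMod (p ^ α))) ^ j * P ^ (p ^ (α - 1) - 1 - j) * T ∈ N) :
    ladder P Z k ≤ N := by
  refine iSup_le fun j => ?_
  rintro _ ⟨T, hT, rfl⟩
  exact h j j.2 T hT

lemma ladder_mono (h : ∀ e, Z e ⊆ Z' e) : ladder P Z k ≤ ladder P Z' k :=
  ladder_le fun j hj _ hT => mem_ladder_of_le hj (restrictSupport_mono _ (h (j + 1)) hT)

lemma ladder_eq_bot (hk : α ≤ k) : ladder P Z k = ⊥ := by
  refine le_bot_iff.1 (ladder_le fun j hj T _ => ?_)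
  rw [natCast_pow_eq_zero (hk.trans hj), zero_mul, zero_mul]
  exact Submodule.zero_mem _

lemma exists_sub_mem_ladder_succ {S : MvPolynomial (Fin 2) (ZMod (p ^ α))}
    (hS : S ∈ ladder P Z k) : ∃ T ∈ restrictSupport (ZMod (p ^ α)) (Z (k + 1)),
      S - (p : MvPolynomial (Fin 2) (ZMod (p ^ α))) ^ k * P ^ (p ^ (α - 1) - 1 - k) * T ∈
        ladder P Z (k + 1) := by
  have hle : ladder P Z k ≤ (restrictSupport (ZMod (p ^ α)) (Z (k + 1))).map
      (LinearMap.mulLeft (ZMod (p ^ α)) ((p : MvPolynomial (Fin 2) (ZMod (p ^ α))) ^ k *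
        P ^ (p ^ (α - 1) - 1 - k))) ⊔ ladder P Z (k + 1) := by
    refine ladder_le fun j hj T hT => ?_
    rcases hj.eq_or_lt with rfl | hj
    · exact Submodule.mem_sup_left ⟨T, hT, rfl⟩
    · exact Submodule.mem_sup_right (mem_ladder_of_le hj hT)
  obtain ⟨_, ⟨T, hT, rfl⟩, S', hS', rfl⟩ := Submodule.mem_sup.1 (hle hS)
  exact ⟨T, hT, by rwa [LinearMap.mulLeft_apply, add_sub_cancel_left]⟩

lemma exists_eq_mul_of_mem_ladder {S : MvPolynomial (Fin 2) (ZMod (p ^ α))}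
    (hS : S ∈ ladder P Z k) : ∃ G, S = (p : MvPolynomial (Fin 2) (ZMod (p ^ α))) ^ k * G := by
  have : ladder P Z k ≤ LinearMap.range (LinearMap.mulLeft (ZMod (p ^ α))
      ((p : MvPolynomial (Fin 2) (ZMod (p ^ α))) ^ k)) := by
    refine ladder_le fun j hj T _ => ?_
    obtain ⟨i, rfl⟩ := Nat.exists_eq_add_of_le hj
    refine ⟨(p : MvPolynomial (Fin 2) (ZMod (p ^ α))) ^ i * P ^ (p ^ (α - 1) - 1 - (k + i)) * T, ?_⟩
    rw [LinearMap.mulLeft_apply]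
    ring
  obtain ⟨G, hG⟩ := this hS
  exact ⟨G, hG.symm⟩

/-- Guarantees that the subtraction in `p ^ (α - 1) - 1 - j` is not truncated on any rung `j < α`;
the higher rungs vanish. -/
lemma le_pow_sub_one (hp : p.Prime) (hα : 1 ≤ α) : α ≤ p ^ (α - 1) := by
  have := (α - 1).lt_pow_self hp.one_lt
  omega

/-- The spare factor `p` raises the rung by one, and a factor `P` split off the power is absorbed by
the digit. Hence a digit matters only modulo `p`, up to higher rungs. -/
lemma mul_mem_ladder_succ [hp : Fact p.Prime] (hα : 1 ≤ α)
    {N : Set (Fin 2 →₀ ℕ)} (hP : P ∈ restrictSupport _ N)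
    (hZ : ∀ e, ∀ m ∈ Z e, ∀ n ∈ N, m + n ∈ Z (e + 1))
    {T : MvPolynomial (Fin 2) (ZMod (p ^ α))}
    (hT : T ∈ restrictSupport (ZMod (p ^ α)) (Z (k + 1))) :
    (p : MvPolynomial (Fin 2) (ZMod (p ^ α))) ^ k * P ^ (p ^ (α - 1) - 1 - k) * (p * T) ∈
      ladder P Z (k + 1) := by
  by_cases hk : k + 1 < α
  · have h1 := le_pow_sub_one hp.out hα
    have h2 : p ^ (α - 1) - 1 - k = (p ^ (α - 1) - 1 - (k + 1)) + 1 := by omega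
    have := mem_ladder_of_le (P := P) (Z := Z) (le_refl (k + 1)) (T := T * P)
      (mul_mem_restrictSupport hT hP (hZ _))
    convert this using 1
    rw [h2]
    ring
  · have : (p : MvPolynomial (Fin 2) (ZMod (p ^ α))) ^ k * P ^ (p ^ (α - 1) - 1 - k) * (p * T) =
        (p : MvPolynomial (Fin 2) (ZMod (p ^ α))) ^ (k + 1) *
          (P ^ (p ^ (α - 1) - 1 - k) * T) := by ring
    rw [this, natCast_pow_eq_zero (α := α) (not_lt.1 hk), zero_mul]
    exact Submodule.zero_mem _

/-- In the binomial expansion of `(expand p P + p * R) ^ l`, each factor `p * R` gains a `p` and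
costs one `P`, that is, climbs one rung; the powers of `expand p P` leave the operator as powers of
`P`. -/
lemma cartier_mem_ladder [hp : Fact p.Prime] (hα : 1 ≤ α) {h d r : ℕ} (hr : r < p)
    (hP : P ∈ restrictSupport _ (newton h d 1))
    (hZ : ∀ e j, ∀ m ∈ Z e, ∀ n ∈ newton h d ((p - 1) * e + p * j), ∀ m',
      p • m' + Finsupp.single 0 r = m + n → m' ∈ Z' (e + j))
    {S : MvPolynomial (Fin 2) (ZMod (p ^ α))} (hS : S ∈ ladder P Z 0) :
    cartier p r (S * (P ^ p ^ (α - 1)) ^ (p - 1)) ∈ ladder P Z' 0 := by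
  suffices hle : ladder P Z 0 ≤ (ladder P Z' 0).comap
      (cartier p r ∘ₗ LinearMap.mulRight (ZMod (p ^ α)) ((P ^ p ^ (α - 1)) ^ (p - 1))) from hle hS
  refine ladder_le fun k _ T hT => ?_
  rw [Submodule.mem_comap, LinearMap.comp_apply, LinearMap.mulRight_apply]
  by_cases hk : α ≤ k
  · rw [natCast_pow_eq_zero hk]
    simp
  have hq := le_pow_sub_one hp.out hα
  obtain ⟨R, hR, hR'⟩ := exists_eq_mul_of_map_eq_zero hα (f := P ^ p - expand p P)
    (by rw [map_sub, map_pow, map_expand, expand_zmod, sub_self])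
    (s := newton h d p) (Submodule.sub_mem _ (by simpa using pow_mem_newton hP p)
      (by simpa using expand_mem_newton (n := p) hP))
  set q := p ^ (α - 1) with hqdef
  -- `l` counts the complete `p`-th powers of `P`: `p * q - (k + 1) = (p - 1) * (k + 1) + p * l`.
  obtain ⟨l, hl⟩ : ∃ l, q = l + (k + 1) := ⟨q - (k + 1), by omega⟩
  obtain ⟨p', hp'⟩ : ∃ p', p = p' + 1 := ⟨p - 1, by have := hp.out.pos; omega⟩
  have hPp : P ^ p = p * R + expand p P := by rw [← hR', sub_add_cancel]
  have hpow : P ^ (q - 1 - k) * (P ^ q) ^ (p - 1) = P ^ ((p - 1) * (k + 1)) * (P ^ p) ^ l := by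
    rw [← pow_mul, ← pow_mul, ← pow_add, ← pow_add]
    congr 1
    rw [hl, hp']
    have : l + (k + 1) - 1 - k = l := by omega
    rw [this]
    simp only [Nat.add_sub_cancel]
    ring
  have hexp : (p : MvPolynomial (Fin 2) (ZMod (p ^ α))) ^ k * P ^ (q - 1 - k) * T *
      (P ^ q) ^ (p - 1) = ∑ j ∈ Finset.range (l + 1),
        ((l.choose j : ZMod (p ^ α)) * (p : ZMod (p ^ α)) ^ (k + j)) •
          (expand p (P ^ (l - j)) * (T * (P ^ ((p - 1) * (k + 1)) * R ^ j))) := by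
    rw [mul_right_comm, mul_assoc _ (P ^ (q - 1 - k)), hpow, hPp, add_pow, Finset.mul_sum,
      Finset.mul_sum, Finset.sum_mul]
    refine Finset.sum_congr rfl fun j _ => ?_
    rw [smul_eq_C_mul, C_mul, map_pow C, map_natCast, map_natCast, map_pow (expand p)]
    ring
  rw [hexp, map_sum]
  refine Submodule.sum_mem _ fun j hj => ?_
  have hj : j ≤ l := Nat.lt_succ_iff.1 (Finset.mem_range.1 hj)
  rw [map_smul, cartier_expand_mul p r hr, mul_smul]
  refine Submodule.smul_mem _ _ ?_
  have hmem := mem_ladder_of_le (P := P) (Z := Z') (Nat.zero_le (k + j))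
    (T := cartier p r (T * (P ^ ((p - 1) * (k + 1)) * R ^ j))) ?_
  · convert hmem using 1
    rw [smul_eq_C_mul, map_pow, map_natCast, mul_assoc]
    congr 3
    omega
  · have hN : P ^ ((p - 1) * (k + 1)) * R ^ j ∈
        restrictSupport (ZMod (p ^ α)) (newton h d ((p - 1) * (k + 1) + p * j)) :=
      mul_mem_newton (by simpa using pow_mem_newton hP ((p - 1) * (k + 1))) (pow_mem_newton hR j)
    have hsum := mul_mem_restrictSupport hT hN (u := Z (k + 1) + newton h d _)
      fun a ha b hb => Set.add_mem_add ha hb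
    refine cartier_mem_restrictSupport hsum fun m hm => ?_
    obtain ⟨a, ha, b, hb, hab⟩ := Set.mem_add.1 hm
    have := hZ (k + 1) j a ha b hb m hab.symm
    rwa [show k + 1 + j = k + j + 1 by ring] at this

section Count

variable [hp : Fact p.Prime] {N : Set (Fin 2 →₀ ℕ)}

/-- The number of elements of `ladder P Z k` is at most the number of possible digits. -/
lemma card_ladder_le (hα : 1 ≤ α) (hP : P ∈ restrictSupport _ N) {Z : ℕ → Finset (Fin 2 →₀ ℕ)}
    (hZ : ∀ e, ∀ m ∈ Z e, ∀ n ∈ N, m + n ∈ Z (e + 1)) (hk : k ≤ α) :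
    (ladder P (fun e => (Z e : Set (Fin 2 →₀ ℕ))) k : Set (MvPolynomial (Fin 2) (ZMod (p ^ α)))).Finite ∧
      (ladder P (fun e => (Z e : Set (Fin 2 →₀ ℕ))) k : Set (MvPolynomial (Fin 2) (ZMod (p ^ α)))).ncard ≤
        p ^ ∑ j ∈ Finset.Ico k α, (Z (j + 1)).card := by
  induction hk using Nat.decreasingInduction with
  | self => simp [ladder_eq_bot le_rfl]
  | of_succ k hk ih =>
    set L := ladder P (fun e => (Z e : Set (Fin 2 →₀ ℕ)))
    let D : (Z (k + 1) → Fin p) → MvPolynomial (Fin 2) (ZMod (p ^ α)) := fun f =>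
      ∑ m : Z (k + 1), monomial (m : Fin 2 →₀ ℕ) ((f m : ℕ) : ZMod (p ^ α))
    let Φ : (Z (k + 1) → Fin p) × MvPolynomial (Fin 2) (ZMod (p ^ α)) →
        MvPolynomial (Fin 2) (ZMod (p ^ α)) := fun x =>
      (p : MvPolynomial (Fin 2) (ZMod (p ^ α))) ^ k * P ^ (p ^ (α - 1) - 1 - k) * D x.1 + x.2
    -- An element is determined by its lowest digit, normalised to coefficients in `0, …, p - 1`,
    -- and a remainder on the next rung; the multiple of `p` discarded from the digit joins the
    -- remainder.
    have hsub : (L k : Set (MvPolynomial (Fin 2) (ZMod (p ^ α)))) ⊆ Φ '' (Set.univ ×ˢ (L (k + 1) : Set (MvPolynomial (Fin 2) (ZMod (p ^ α))))) := by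
      intro S hS
      obtain ⟨T, hT, hST⟩ := exists_sub_mem_ladder_succ hS
      let f : Z (k + 1) → Fin p := fun m =>
        ⟨(T.coeff (m : Fin 2 →₀ ℕ)).val % p, Nat.mod_lt _ hp.out.pos⟩
      have hD : D f ∈ restrictSupport (ZMod (p ^ α)) (Z (k + 1) : Set (Fin 2 →₀ ℕ)) :=
        Submodule.sum_mem _ fun m _ => (monomial_mem_restrictSupport _).2 (Or.inl m.2)
      have hred : map (redModP hα) (T - D f) = 0 := by
        ext m
        rw [coeff_map, coeff_zero, coeff_sub, map_sub, sub_eq_zero]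
        by_cases hm : m ∈ Z (k + 1)
        · have : (D f).coeff m = ((f ⟨m, hm⟩ : ℕ) : ZMod (p ^ α)) := by
            rw [coeff_sum, Finset.sum_eq_single ⟨m, hm⟩]
            · rw [coeff_monomial, if_pos rfl]
            · intro b _ hb
              rw [coeff_monomial, if_neg]
              exact fun h => hb (Subtype.ext h)
            · simp
          rw [this, map_natCast, ZMod.natCast_mod, ← map_natCast (redModP hα),
            ZMod.natCast_zmod_val]
        · rw [coeff_eq_zero_of_mem_restrictSupport hT hm,
            coeff_eq_zero_of_mem_restrictSupport hD hm]
      obtain ⟨R, hR, hTR⟩ := exists_eq_mul_of_map_eq_zero hα hred (Submodule.sub_mem _ hT hD)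
      refine ⟨(f, S - (p : MvPolynomial (Fin 2) (ZMod (p ^ α))) ^ k *
        P ^ (p ^ (α - 1) - 1 - k) * D f), ⟨trivial, ?_⟩, by simp [Φ]⟩
      have h2 := mul_mem_ladder_succ (k := k) hα hP (Z := fun e => (Z e : Set (Fin 2 →₀ ℕ)))
        (fun e m hm n hn => Finset.mem_coe.2 (hZ e m (Finset.mem_coe.1 hm) n hn)) hR
      have h3 := Submodule.add_mem _ hST h2
      rw [← hTR, mul_sub, sub_add_sub_cancel] at h3
      exact h3
    have hfin : (Set.univ ×ˢ (L (k + 1) : Set (MvPolynomial (Fin 2) (ZMod (p ^ α)))) :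
        Set ((Z (k + 1) → Fin p) × MvPolynomial (Fin 2) (ZMod (p ^ α)))).Finite :=
      Set.finite_univ.prod ih.1
    refine ⟨(hfin.image Φ).subset hsub, ?_⟩
    calc (L k : Set (MvPolynomial (Fin 2) (ZMod (p ^ α)))).ncard ≤ _ := Set.ncard_le_ncard hsub (hfin.image Φ)
      _ ≤ _ := Set.ncard_image_le hfin
      _ = p ^ (Z (k + 1)).card * (L (k + 1) : Set (MvPolynomial (Fin 2) (ZMod (p ^ α)))).ncard := by
        rw [Set.ncard_prod, Set.ncard_univ, Nat.card_eq_fintype_card, Fintype.card_fun,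
          Fintype.card_fin, Fintype.card_coe]
      _ ≤ p ^ (Z (k + 1)).card * p ^ ∑ j ∈ Finset.Ico (k + 1) α, (Z (j + 1)).card :=
        Nat.mul_le_mul_left _ ih.2
      _ = _ := by rw [← pow_add, Finset.sum_eq_sum_Ico_succ_bot hk]

end Count

end Ladder

/-! ### Extremal coefficients as one-variable polynomials. -/

section Face

open Polynomial

variable {A : Type*} [CommRing A]

/-- The isomorphism `A[x, y] → A[X][Y]` for which the variable `i` is sent to the outer variable
`Y`. -/
noncomputable def slice (i : Fin 2) : MvPolynomial (Fin 2) A →ₐ[A] A[X][X] :=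
  MvPolynomial.aeval fun j => if j = i then X else C X

lemma coeff_coeff_slice (i : Fin 2) (S : MvPolynomial (Fin 2) A) (a b : ℕ) :
    ((slice i S).coeff a).coeff b =
      S.coeff (Finsupp.single i a + Finsupp.single (1 - i) b) := by
  induction S using MvPolynomial.induction_on' with
  | add f g hf hg => rw [map_add, coeff_add, coeff_add, MvPolynomial.coeff_add, hf, hg]
  | monomial n r =>
    have h : slice i (MvPolynomial.monomial n r) = monomial (n i) (monomial (n (1 - i)) r) := by
      rw [slice, MvPolynomial.aeval_monomial, Finsupp.prod_fintype _ _ (by simp), Fin.prod_univ_two,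
        ← C_mul_X_pow_eq_monomial, ← C_mul_X_pow_eq_monomial, Polynomial.algebraMap_apply,
        Polynomial.algebraMap_apply, Algebra.algebraMap_self, RingHom.id_apply]
      fin_cases i <;> simp <;> ring
    rw [h, coeff_monomial, MvPolynomial.coeff_monomial]
    have hiff : n = Finsupp.single i a + Finsupp.single (1 - i) b ↔ n i = a ∧ n (1 - i) = b := by
      constructor
      · rintro rfl
        fin_cases i <;> simp
      · rintro ⟨rfl, rfl⟩
        ext j
        fin_cases i <;> fin_cases j <;> simp
    rw [if_congr hiff rfl rfl]
    split_ifs with h1 h2 h2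
    · rw [coeff_monomial, if_pos h2.2]
    · rw [coeff_monomial, if_neg fun h3 => h2 ⟨h1, h3⟩]
    · exact absurd h2.1 h1
    · simp

lemma coeff_eq_coeff_coeff_slice (i : Fin 2) (m : Fin 2 →₀ ℕ) (S : MvPolynomial (Fin 2) A) :
    S.coeff m = ((slice i S).coeff (m i)).coeff (m (1 - i)) := by
  rw [coeff_coeff_slice]
  congr 1
  ext j
  fin_cases i <;> fin_cases j <;> simp

/-- The coefficient of `S`, as a polynomial in the variable `i`, in degree `c * a`.  For `c = 0`
this is the lowest coefficient, otherwise it is used for polynomials of degree at most `c * a`. -/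
noncomputable def face (i : Fin 2) (c a : ℕ) (S : MvPolynomial (Fin 2) A) : A[X] :=
  (slice i S).coeff (c * a)

/-- The half space of exponents for which `face i c a` is an extremal coefficient. -/
def faceDomain (i : Fin 2) (c a : ℕ) : Set (Fin 2 →₀ ℕ) := {m | c = 0 ∨ m i ≤ c * a}

open MvPolynomial (restrictSupport)

lemma natDegree_slice_le {i : Fin 2} {n : ℕ} {S : MvPolynomial (Fin 2) A}
    (hS : S ∈ restrictSupport A {m | m i ≤ n}) : (slice i S).natDegree ≤ n := by
  refine natDegree_le_iff_coeff_eq_zero.2 fun k hk => ?_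
  ext b
  rw [coeff_coeff_slice, coeff_zero]
  refine coeff_eq_zero_of_mem_restrictSupport hS ?_
  fin_cases i <;> simpa using hk

lemma face_add (i : Fin 2) (c a : ℕ) (S T : MvPolynomial (Fin 2) A) :
    face i c a (S + T) = face i c a S + face i c a T := by
  rw [face, map_add, coeff_add]; rfl

lemma face_natCast_pow_mul (i : Fin 2) (c a n k : ℕ) (S : MvPolynomial (Fin 2) A) :
    face i c a ((n : MvPolynomial (Fin 2) A) ^ k * S) = (n : A[X]) ^ k * face i c a S := by
  rw [face, ← Nat.cast_pow, map_mul, map_natCast, coeff_natCast_mul, Nat.cast_pow]; rfl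

lemma face_mul {i : Fin 2} {c a b : ℕ} {S T : MvPolynomial (Fin 2) A}
    (hS : S ∈ restrictSupport A (faceDomain i c a))
    (hT : T ∈ restrictSupport A (faceDomain i c b)) :
    face i c (a + b) (S * T) = face i c a S * face i c b T := by
  unfold face
  rw [map_mul]
  rcases Nat.eq_zero_or_pos c with rfl | hc
  · simp [mul_coeff_zero]
  · rw [mul_add]
    have h (a : ℕ) : faceDomain i c a = {m | m i ≤ c * a} := by
      ext m; simp [faceDomain, hc.ne']
    rw [h] at hS hT
    exact coeff_mul_add_eq_of_natDegree_le (natDegree_slice_le hS) (natDegree_slice_le hT)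

lemma mul_mem_faceDomain {i : Fin 2} {c a b : ℕ} {S T : MvPolynomial (Fin 2) A}
    (hS : S ∈ restrictSupport A (faceDomain i c a))
    (hT : T ∈ restrictSupport A (faceDomain i c b)) :
    S * T ∈ restrictSupport A (faceDomain i c (a + b)) := by
  refine mul_mem_restrictSupport hS hT fun u hu v hv => ?_
  simp only [faceDomain, Set.mem_ofPred_eq, Finsupp.add_apply, mul_add] at *
  omega

lemma one_mem_faceDomain (i : Fin 2) (c : ℕ) :
    (1 : MvPolynomial (Fin 2) A) ∈ restrictSupport A (faceDomain i c 0) := by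
  rw [← MvPolynomial.C_1, MvPolynomial.C_apply]
  exact (MvPolynomial.monomial_mem_restrictSupport _).2 (Or.inl (by simp [faceDomain]))

lemma pow_mem_faceDomain {i : Fin 2} {c a : ℕ} {S : MvPolynomial (Fin 2) A}
    (hS : S ∈ restrictSupport A (faceDomain i c a)) (n : ℕ) :
    S ^ n ∈ restrictSupport A (faceDomain i c (a * n)) := by
  induction n with
  | zero => simpa using one_mem_faceDomain i c
  | succ n ih => rw [pow_succ, mul_add, mul_one]; exact mul_mem_faceDomain ih hS

lemma face_pow {i : Fin 2} {c a : ℕ} {S : MvPolynomial (Fin 2) A}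
    (hS : S ∈ restrictSupport A (faceDomain i c a)) (n : ℕ) :
    face i c (a * n) (S ^ n) = face i c a S ^ n := by
  induction n with
  | zero => simp [face]
  | succ n ih =>
    rw [pow_succ, mul_add, mul_one, face_mul (pow_mem_faceDomain hS n) hS, ih, pow_succ]

lemma face_cartier {p : ℕ} [NeZero p] (i : Fin 2) (c a : ℕ) (S : MvPolynomial (Fin 2) A) :
    face i c a (cartier p 0 S) = contract p (face i c (p * a) S) := by
  ext n
  rw [coeff_contract (NeZero.ne p), face, face, coeff_coeff_slice, coeff_coeff_slice, coeff_cartier]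
  congr 1
  simp only [Finsupp.single_zero, add_zero, smul_add, Finsupp.smul_single, smul_eq_mul]
  rw [mul_left_comm, mul_comm n]

end Face

/-! ### Ladder elements with vanishing faces. -/

section FaceKernel

open MvPolynomial (restrictSupport)
open Polynomial

variable {p α : ℕ}

lemma map_redModP_eq_zero_of_mul (hα : 1 ≤ α) [hp : Fact p.Prime] {k : ℕ} (hk : k < α)
    {f : (ZMod (p ^ α))[X]} (h : (p : (ZMod (p ^ α))[X]) ^ k * f = 0) :
    f.map (redModP hα) = 0 := by
  ext n
  have h1 := congrArg (fun g => g.coeff n) h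
  simp only [← Nat.cast_pow, coeff_natCast_mul, coeff_zero] at h1
  rw [coeff_map, coeff_zero]
  obtain ⟨a, ha⟩ : ∃ a : ℕ, f.coeff n = a := ⟨(f.coeff n).val, by rw [ZMod.natCast_zmod_val]⟩
  rw [ha, ← Nat.cast_mul, ZMod.natCast_eq_zero_iff] at h1
  rw [ha, map_natCast, ZMod.natCast_eq_zero_iff]
  obtain ⟨l, rfl⟩ := Nat.exists_eq_add_of_lt hk
  rw [add_assoc, pow_add] at h1
  exact (dvd_pow_self p (Nat.succ_ne_zero l)).trans
    (Nat.dvd_of_mul_dvd_mul_left (Nat.pow_pos hp.out.pos) h1)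

variable {P : MvPolynomial (Fin 2) (ZMod (p ^ α))} {Z : ℕ → Set (Fin 2 →₀ ℕ)}

/-- An element of the ladder all of whose faces vanish can be written with digits that have no
monomial on these faces. -/
lemma mem_ladder_of_face_eq_zero [hp : Fact p.Prime] (hα : 1 ≤ α) {N : Set (Fin 2 →₀ ℕ)}
    (hP : P ∈ restrictSupport _ N) (hZN : ∀ e, ∀ m ∈ Z e, ∀ n ∈ N, m + n ∈ Z (e + 1))
    (Ψ : Finset (Fin 2 × ℕ)) (hZ : ∀ ψ ∈ Ψ, ∀ e, Z e ⊆ faceDomain ψ.1 ψ.2 e)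
    (hPΨ : ∀ ψ ∈ Ψ, P ∈ restrictSupport _ (faceDomain ψ.1 ψ.2 1))
    (hP0 : ∀ ψ ∈ Ψ, (face ψ.1 ψ.2 1 P).map (redModP hα) ≠ 0) {k : ℕ} (hk : k ≤ α) :
    ∀ S ∈ ladder P Z k, (∀ ψ ∈ Ψ, face ψ.1 ψ.2 (p ^ (α - 1)) S = 0) →
      S ∈ ladder P (fun e => {m | m ∈ Z e ∧ ∀ ψ ∈ Ψ, m ψ.1 ≠ ψ.2 * e}) k := by
  classical
  induction hk using Nat.decreasingInduction with
  | self =>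
    intro S hS _
    rw [ladder_eq_bot le_rfl] at hS ⊢
    exact hS
  | of_succ k hk ih =>
    intro S hS hface
    have hq := le_pow_sub_one hp.out hα
    set q := p ^ (α - 1) with hqdef
    have hqk : (k + 1) + 1 * (q - 1 - k) = q := by omega
    have hface_term : ∀ ψ ∈ Ψ, ∀ T ∈ restrictSupport (ZMod (p ^ α)) (Z (k + 1)),
        face ψ.1 ψ.2 q ((p : MvPolynomial (Fin 2) (ZMod (p ^ α))) ^ k * P ^ (q - 1 - k) * T) =
          (p : (ZMod (p ^ α))[X]) ^ k *
            (face ψ.1 ψ.2 (k + 1) T * face ψ.1 ψ.2 1 P ^ (q - 1 - k)) := by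
      intro ψ hψ T hT
      rw [mul_assoc, mul_comm _ T, face_natCast_pow_mul]
      have h1 := face_mul (MvPolynomial.restrictSupport_mono _ (hZ ψ hψ (k + 1)) hT)
        (pow_mem_faceDomain (hPΨ ψ hψ) (q - 1 - k))
      rw [face_pow (hPΨ ψ hψ), hqk] at h1
      rw [h1]
    obtain ⟨T, hT, hST⟩ := exists_sub_mem_ladder_succ hS
    let good : (Fin 2 →₀ ℕ) → Prop := fun m => ∀ ψ ∈ Ψ, m ψ.1 ≠ ψ.2 * (k + 1)
    let T' : MvPolynomial (Fin 2) (ZMod (p ^ α)) :=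
      ∑ m ∈ T.support.filter good, MvPolynomial.monomial m (T.coeff m)
    have hT'coeff (m) : T'.coeff m = if good m then T.coeff m else 0 := by
      simp only [T', MvPolynomial.coeff_sum, MvPolynomial.coeff_monomial, Finset.sum_ite_eq',
        Finset.mem_filter, MvPolynomial.mem_support_iff]
      split_ifs with h1 h2 h2 <;> simp_all
    have hT' : T' ∈ restrictSupport (ZMod (p ^ α)) {m | m ∈ Z (k + 1) ∧ good m} := by
      refine mem_restrictSupport_of_coeff fun m hm => ?_
      rw [hT'coeff] at hm
      have hg : good m := by
        by_contra h; rw [if_neg h] at hm; exact hm rfl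
      rw [if_pos hg] at hm
      refine ⟨?_, hg⟩
      by_contra h
      exact hm (coeff_eq_zero_of_mem_restrictSupport hT h)
    have hT'Z : T' ∈ restrictSupport (ZMod (p ^ α)) (Z (k + 1)) :=
      MvPolynomial.restrictSupport_mono _ (fun m hm => hm.1) hT'
    -- The face of `S` is `p ^ k * (face T * face P ^ _ + p * _)`. Cancelling `p ^ k` leaves a
    -- vanishing product over the domain `(ZMod p)[X]`, where the face of `P` is nonzero. So the
    -- face monomials of `T` have coefficients divisible by `p` and can be moved to the next rung.
    have hface_T (ψ) (hψ : ψ ∈ Ψ) : (face ψ.1 ψ.2 (k + 1) T).map (redModP hα) = 0 := by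
      obtain ⟨G, hG⟩ := exists_eq_mul_of_mem_ladder hST
      have h1 := hface ψ hψ
      rw [← sub_add_cancel S, add_comm, face_add, hface_term ψ hψ T hT, hG, face_natCast_pow_mul,
        pow_succ, mul_assoc, ← mul_add] at h1
      have h2 := map_redModP_eq_zero_of_mul hα hk h1
      rw [Polynomial.map_add, Polynomial.map_mul, Polynomial.map_mul, Polynomial.map_natCast,
        CharP.cast_eq_zero, zero_mul, add_zero, Polynomial.map_pow] at h2
      exact (mul_eq_zero.1 h2).resolve_right (pow_ne_zero _ (hP0 ψ hψ))
    have hred : MvPolynomial.map (redModP hα) (T - T') = 0 := by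
      ext m
      rw [MvPolynomial.coeff_map, MvPolynomial.coeff_zero, MvPolynomial.coeff_sub, hT'coeff]
      split_ifs with hg
      · rw [sub_self, map_zero]
      · have : ∃ ψ ∈ Ψ, m ψ.1 = ψ.2 * (k + 1) := by
          simpa only [good, not_forall, exists_prop, not_not, ne_eq] using hg
        obtain ⟨ψ, hψ, hm⟩ := this
        have h1 := congrArg (fun g => g.coeff (m (1 - ψ.1))) (hface_T ψ hψ)
        simp only [coeff_map, coeff_zero, face, ← hm, ← coeff_eq_coeff_coeff_slice] at h1
        rw [sub_zero, h1]
    obtain ⟨R, hR, hTR⟩ := exists_eq_mul_of_map_eq_zero hα hred (Submodule.sub_mem _ hT hT'Z)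
    have h3 := Submodule.add_mem _ hST (mul_mem_ladder_succ (k := k) hα hP hZN hR)
    rw [← hTR, mul_sub, sub_add_sub_cancel] at h3
    have hT'0 (ψ) (hψ : ψ ∈ Ψ) : face ψ.1 ψ.2 (k + 1) T' = 0 := by
      ext n
      rw [face, coeff_coeff_slice, coeff_zero]
      refine coeff_eq_zero_of_mem_restrictSupport hT' fun h => h.2 ψ hψ ?_
      generalize ψ.1 = i
      fin_cases i <;> simp
    have h4 := ih _ h3 fun ψ hψ => by
      have h5 := hface ψ hψ
      rwa [← sub_add_cancel S, face_add, hface_term ψ hψ T' hT'Z, hT'0 ψ hψ, zero_mul, mul_zero,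
        add_zero] at h5
    have hle : ladder P (fun e => {m | m ∈ Z e ∧ ∀ ψ ∈ Ψ, m ψ.1 ≠ ψ.2 * e}) (k + 1) ≤
        ladder P (fun e => {m | m ∈ Z e ∧ ∀ ψ ∈ Ψ, m ψ.1 ≠ ψ.2 * e}) k :=
      ladder_le fun j hj T hT => mem_ladder_of_le (k.le_succ.trans hj) hT
    have h6 := Submodule.add_mem _ (hle h4) (mem_ladder_of_le (P := P)
      (Z := fun e => {m | m ∈ Z e ∧ ∀ ψ ∈ Ψ, m ψ.1 ≠ ψ.2 * e}) (le_refl k) hT')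
    rwa [sub_add_cancel] at h6

end FaceKernel

/-! ### Eventual periodicity of the one-variable Cartier map. -/

section Periodic

open Polynomial

/-- Modulo `(u - 1) ^ p ^ n` the element `u ^ p ^ n` is congruent to `1` modulo `p`; another `α - 1`
`p`-th powers make it equal to `1`. -/
lemma sub_one_pow_dvd {p α : ℕ} [hp : Fact p.Prime] (hα : 1 ≤ α) {R : Type*} [CommRing R]
    [Algebra (ZMod (p ^ α)) R] (u : R) (n : ℕ) :
    (u - 1) ^ p ^ n ∣ u ^ p ^ (n + (α - 1)) - 1 := by
  set I := Ideal.span {(u - 1) ^ p ^ n}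
  let v : R ⧸ I := Ideal.Quotient.mk I u
  have hv : (v - 1) ^ p ^ n = 0 := by
    have : Ideal.Quotient.mk I ((u - 1) ^ p ^ n) = 0 :=
      Ideal.Quotient.eq_zero_iff_mem.2 (Ideal.mem_span_singleton_self _)
    simpa [v] using this
  have h1 : (p : R ⧸ I) ∣ v ^ p ^ n - 1 := by
    obtain ⟨r, hr⟩ := exists_add_pow_prime_pow_eq hp.out (v - 1) 1 n
    rw [sub_add_cancel, hv, one_pow, zero_add] at hr
    exact ⟨(v - 1) * 1 * r, by rw [hr]; ring⟩
  have h2 := pow_pow_eq_of_dvd_sub hα h1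
  rw [one_pow, ← pow_mul, ← pow_add] at h2
  rw [← Ideal.mem_span_singleton, ← Ideal.Quotient.eq_zero_iff_mem, map_sub, map_pow, map_one]
  exact sub_eq_zero.2 h2

variable {p α : ℕ}

lemma natCast_dvd_of_map_redModP_eq_zero (hα : 1 ≤ α) [NeZero p] {f : (ZMod (p ^ α))[X]}
    (h : f.map (redModP hα) = 0) : (p : (ZMod (p ^ α))[X]) ∣ f := by
  rw [← map_natCast C, C_dvd_iff_dvd_coeff]
  intro n
  obtain ⟨b, hb⟩ := (redModP_eq_zero_iff hα (f.coeff n)).1 (by rw [← coeff_map, h, coeff_zero])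
  exact ⟨b, hb⟩

lemma redModP_surjective (hα : 1 ≤ α) : Function.Surjective (redModP (p := p) hα) :=
  ZMod.castHom_surjective _

lemma natDegree_X_pow_sub_X_pow {R : Type*} [CommRing R] [Nontrivial R] {a b : ℕ} (h : b < a) :
    (X ^ a - X ^ b : R[X]).Monic ∧ (X ^ a - X ^ b : R[X]).natDegree = a := by
  have hd : (X ^ b : R[X]).degree < (X ^ a : R[X]).degree := by
    rw [degree_X_pow, degree_X_pow]; exact_mod_cast h
  refine ⟨(monic_X_pow a).sub_of_left hd, ?_⟩
  rw [natDegree_sub_eq_left_of_natDegree_lt, natDegree_X_pow]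
  rwa [natDegree_X_pow, natDegree_X_pow]

/-- Modulo `p ^ α`, a power of `Q` divides a difference of two monomials. -/
lemma exists_pow_mul_eq_X_pow_sub_X_pow [hp : Fact p.Prime] (hα : 1 ≤ α) {m s : ℕ} (hm : 1 ≤ m)
    {Q : (ZMod (p ^ α))[X]} (hQ : Q.map (redModP hα) ∣ (X ^ p ^ m - X) ^ p ^ s) :
    ∃ W : (ZMod (p ^ α))[X], W.natDegree ≤ p ^ (s + 2 * (α - 1) + m) ∧
      Q ^ p ^ (α - 1) * W = X ^ p ^ (s + 2 * (α - 1) + m) - X ^ p ^ (s + 2 * (α - 1)) := by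
  have : Nontrivial (ZMod (p ^ α)) :=
    ZMod.nontrivial_iff.2 (Nat.one_lt_pow (by omega) hp.out.one_lt).ne'
  have h1m : 1 < p ^ m := Nat.one_lt_pow (by omega) hp.out.one_lt
  obtain ⟨w, hw⟩ := hQ
  -- The cofactor is lifted with unchanged support, which keeps its degree under control.
  obtain ⟨W₀, hW₀, hsupp⟩ := exists_support_eq_of_mem_lifts (f := redModP hα) (p := w)
    ((lifts_iff_coeff_lifts _).2 fun n => redModP_surjective hα _)
  have hdeg : W₀.natDegree = w.natDegree := by rw [natDegree, natDegree, degree, degree, hsupp]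
  have hmon := natDegree_X_pow_sub_X_pow (R := ZMod (p ^ α)) h1m
  have hmon' := natDegree_X_pow_sub_X_pow (R := ZMod p) h1m
  rw [pow_one] at hmon hmon'
  have hdegw : W₀.natDegree ≤ p ^ (m + s) := by
    have hne : Q.map (redModP hα) * w ≠ 0 := hw ▸ (hmon'.1.pow _).ne_zero
    rw [hdeg, pow_add, mul_comm (p ^ m), ← hmon'.2, ← hmon'.1.natDegree_pow, hw,
      natDegree_mul (left_ne_zero_of_mul hne) (right_ne_zero_of_mul hne)]
    exact Nat.le_add_left _ _
  have hpow : (Q * W₀) ^ p ^ (α - 1) = ((X ^ p ^ m - X) ^ p ^ s) ^ p ^ (α - 1) := by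
    refine pow_pow_eq_of_dvd_sub hα (natCast_dvd_of_map_redModP_eq_zero hα ?_)
    rw [Polynomial.map_sub, Polynomial.map_mul, hW₀, ← hw]
    simp
  -- In the exponent `s + 2 * (α - 1)`, one `α - 1` comes from the lift in `hpow` and the other from
  -- `sub_one_pow_dvd`.
  obtain ⟨E, hE⟩ : ((X ^ p ^ m - X) ^ p ^ s : (ZMod (p ^ α))[X]) ^ p ^ (α - 1) ∣
      X ^ p ^ (s + 2 * (α - 1) + m) - X ^ p ^ (s + 2 * (α - 1)) := by
    have e1 : (X ^ p ^ m - X : (ZMod (p ^ α))[X]) = X * (X ^ (p ^ m - 1) - 1) := by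
      rw [mul_sub, ← pow_succ', Nat.sub_add_cancel h1m.le, mul_one]
    have e2 : (X ^ p ^ (s + 2 * (α - 1) + m) - X ^ p ^ (s + 2 * (α - 1)) : (ZMod (p ^ α))[X]) =
        X ^ p ^ (s + 2 * (α - 1)) * ((X ^ (p ^ m - 1)) ^ p ^ ((s + (α - 1)) + (α - 1)) - 1) := by
      rw [mul_sub, ← pow_mul, ← pow_add, mul_one, show s + (α - 1) + (α - 1) = s + 2 * (α - 1) by ring,
        pow_add p (s + 2 * (α - 1)) m]
      congr 2
      obtain ⟨n, hn⟩ := Nat.exists_eq_add_of_le h1m.le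
      rw [hn, Nat.add_sub_cancel_left]
      ring
    rw [← pow_mul, ← pow_add, e1, e2, mul_pow]
    exact mul_dvd_mul (pow_dvd_pow _ (Nat.pow_le_pow_right hp.out.pos (by omega)))
      (sub_one_pow_dvd hα _ _)
  refine ⟨W₀ ^ p ^ (α - 1) * E, ?_, ?_⟩
  · have hT := (natDegree_X_pow_sub_X_pow (R := ZMod (p ^ α)) (a := p ^ (s + 2 * (α - 1) + m))
      (b := p ^ (s + 2 * (α - 1))) (Nat.pow_lt_pow_right hp.out.one_lt (by omega))).2
    have hEd := ((hmon.1.pow (p ^ s)).pow (p ^ (α - 1))).natDegree_mul' (q := E) (by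
      rintro rfl
      rw [mul_zero] at hE
      rw [hE, natDegree_zero] at hT
      exact (Nat.pow_pos hp.out.pos).ne hT)
    rw [← hE, hT, (hmon.1.pow (p ^ s)).natDegree_pow, hmon.1.natDegree_pow, hmon.2] at hEd
    calc _ ≤ (W₀ ^ p ^ (α - 1)).natDegree + E.natDegree := natDegree_mul_le
      _ ≤ p ^ (α - 1) * p ^ (m + s) + E.natDegree := by
        gcongr
        exact natDegree_pow_le.trans (Nat.mul_le_mul_left _ hdegw)
      _ = _ := by rw [hEd]; ring
  · rw [← mul_assoc, ← mul_pow, hpow, hE]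

/-! ### Contraction of fractions with denominator `X ^ M - X`. -/

section Idempotent

variable {R : Type*} [CommRing R]

/-- The polynomial `E` with `(X ^ M - X) * E = X ^ M ^ 2 - X ^ M` for `M = n + 1`. -/
noncomputable def geomFactor (R : Type*) [CommRing R] (n : ℕ) : R[X] :=
  ∑ i ∈ Finset.range (n + 1), X ^ (n * (i + 1))

lemma sub_mul_geomFactor (n : ℕ) : (X ^ (n + 1) - X) * geomFactor R n =
    expand R (n + 1) (X ^ (n + 1) - X) := by
  have h := mul_geom_sum (X ^ n : R[X]) (n + 1)
  have hE : geomFactor R n = X ^ n * ∑ i ∈ Finset.range (n + 1), (X ^ n) ^ i := by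
    rw [geomFactor, Finset.mul_sum]
    exact Finset.sum_congr rfl fun i _ => by ring
  calc _ = X * X ^ n * ((X ^ n - 1) * ∑ i ∈ Finset.range (n + 1), (X ^ n : R[X]) ^ i) := by
        rw [hE]; ring
    _ = _ := by
      rw [h, map_sub, map_pow, expand_X]; ring

lemma coeff_contract_geomFactor_mul (n b : ℕ) (V : R[X]) :
    (contract (n + 1) (geomFactor R n * V)).coeff b = ∑ i ∈ Finset.range (n + 1),
      if n * (i + 1) ≤ b * (n + 1) then V.coeff (b * (n + 1) - n * (i + 1)) else 0 := by
  rw [coeff_contract (Nat.succ_ne_zero n), geomFactor, Finset.sum_mul, finsetSum_coeff]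
  exact Finset.sum_congr rfl fun i _ => by rw [coeff_X_pow_mul']

lemma natDegree_contract_geomFactor_mul {n : ℕ} {V : R[X]} (hV : V.natDegree ≤ n + 1) :
    (contract (n + 1) (geomFactor R n * V)).natDegree ≤ n + 1 := by
  refine natDegree_le_iff_coeff_eq_zero.2 fun b hb => ?_
  rw [coeff_contract_geomFactor_mul]
  refine Finset.sum_eq_zero fun i hi => ?_
  rw [if_pos, coeff_eq_zero_of_natDegree_lt]
  all_goals
    have hi : i + 1 ≤ n + 1 := Finset.mem_range.1 hi
    have h1 := Nat.mul_le_mul_left n hi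
    have h2 := Nat.mul_le_mul_right (n + 1) (Nat.succ_le_of_lt hb)
    have h3 : n * (n + 1) + 2 * (n + 1) = (n + 1 + 1) * (n + 1) := by ring
    rw [Nat.succ_eq_add_one] at h2
  · omega
  · omega

lemma coeff_zero_contract_geomFactor_mul {n : ℕ} (hn : 1 ≤ n) (V : R[X]) :
    (contract (n + 1) (geomFactor R n * V)).coeff 0 = 0 := by
  rw [coeff_contract_geomFactor_mul]
  refine Finset.sum_eq_zero fun i hi => if_neg ?_
  have := Nat.mul_pos hn (Nat.succ_pos i)
  simp only [Nat.succ_eq_add_one] at this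
  omega

/-- With `M = n + 1`, the map replaces the coefficients `c k` of the series `V / (X ^ M - X)` by `c
(M * k)`. As `X ∣ V` and `deg V ≤ M`, for `k ≥ 1` they depend only on `k` modulo `M - 1`, and `M * k
≡ k`. -/
lemma contract_geomFactor_mul_eq_self {n : ℕ} (hn : 1 ≤ n) {V : R[X]} (hV : V.natDegree ≤ n + 1)
    (hV0 : V.coeff 0 = 0) : contract (n + 1) (geomFactor R n * V) = V := by
  ext b
  by_cases hb : n + 1 < b
  · rw [coeff_eq_zero_of_natDegree_lt ((natDegree_contract_geomFactor_mul hV).trans_lt hb),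
      coeff_eq_zero_of_natDegree_lt (hV.trans_lt hb)]
  rcases b.eq_zero_or_pos with rfl | hb0
  · rw [coeff_zero_contract_geomFactor_mul hn, hV0]
  rw [coeff_contract_geomFactor_mul, Finset.sum_eq_single (b - 1)]
  · have : b * (n + 1) - n * (b - 1 + 1) = b := by
      rw [Nat.sub_add_cancel hb0, mul_add, mul_comm n]; omega
    rw [this, if_pos]
    rw [Nat.sub_add_cancel hb0, mul_add, mul_comm n]; omega
  · intro i hi hib
    have hi : i < n + 1 := Finset.mem_range.1 hi
    split_ifs with hle
    · rcases lt_or_gt_of_ne hib with hlt | hgt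
      · obtain ⟨k, rfl⟩ : ∃ k, b = i + 2 + k := ⟨b - i - 2, by omega⟩
        refine coeff_eq_zero_of_natDegree_lt (hV.trans_lt ?_)
        have : (i + 2 + k) * (n + 1) = n * (i + 1) + (n + i + 2 + k + n * k) := by ring
        rw [this, Nat.add_sub_cancel_left]
        omega
      -- Here `hle` forces `k = 0` and `b = n`, so only the constant coefficient of `V` is met.
      · obtain ⟨k, rfl⟩ : ∃ k, i = b + k := ⟨i - b, by omega⟩
        have : n * (b + k + 1) = b * (n + 1) + (n + n * k) - b := by
          rw [show b * (n + 1) + (n + n * k) = n * (b + k + 1) + b by ring, Nat.add_sub_cancel]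
        have h2 : b * (n + 1) - n * (b + k + 1) = 0 := by omega
        rw [h2, hV0]
    · rfl
  · intro h
    exact absurd (Finset.mem_range.2 (by omega)) h

end Idempotent

lemma contract_expand_mul {R : Type*} [CommRing R] {n : ℕ} (hn : n ≠ 0) (f g : R[X]) :
    contract n (expand R n f * g) = f * contract n g := by
  rw [mul_comm, contract_mul_expand hn, mul_comm]

lemma contract_contract {R : Type*} [CommRing R] {m n : ℕ} (hm : m ≠ 0) (hn : n ≠ 0) (f : R[X]) :
    contract m (contract n f) = contract (n * m) f := by
  ext k
  rw [coeff_contract hm, coeff_contract hn, coeff_contract (mul_ne_zero hn hm)]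
  congr 1
  ring

/-- On fractions `U / B` the map is plain contraction by `p`, because `expand p B = B ^ p`;
contractions compose. -/
lemma iterate_contract {R : Type*} [CommRing R] {p : ℕ} (hp : p ≠ 0) {B : R[X]}
    (hB : expand R p B = B ^ p) (t : ℕ) (U : R[X]) :
    (fun U => contract p (U * B ^ (p - 1)))^[t] U = contract (p ^ t) (U * B ^ (p ^ t - 1)) := by
  induction t generalizing U with
  | zero => simp [contract_one]
  | succ t ih =>
    have hpt : 1 ≤ p ^ t := Nat.one_le_pow _ _ (Nat.pos_of_ne_zero hp)
    rw [Function.iterate_succ_apply, ih, mul_comm, ← contract_expand_mul hp, map_pow, hB,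
      contract_contract (by positivity) hp, ← pow_mul, mul_left_comm, ← pow_add, pow_succ']
    congr 3
    obtain ⟨k, hk⟩ := Nat.exists_eq_add_of_le hpt
    obtain ⟨l, rfl⟩ := Nat.exists_eq_succ_of_ne_zero hp
    rw [hk, Nat.succ_sub_one, Nat.add_sub_cancel_left, Nat.succ_eq_add_one]
    have : (l + 1) * (1 + k) = (l + 1) * k + l + 1 := by ring
    rw [this, Nat.add_sub_cancel]

lemma expand_pow_eq_univariate [hp : Fact p.Prime] (hα : 1 ≤ α) (Q : (ZMod (p ^ α))[X]) :
    expand _ p (Q ^ p ^ (α - 1)) = (Q ^ p ^ (α - 1)) ^ p := by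
  rw [map_pow, ← pow_mul, mul_comm, pow_mul]
  refine pow_pow_eq_of_dvd_sub hα (natCast_dvd_of_map_redModP_eq_zero hα ?_)
  rw [Polynomial.map_sub, Polynomial.map_pow, map_expand, ZMod.expand_card, sub_self]

lemma expand_pow_pow {R : Type*} [CommRing R] {p : ℕ} {B : R[X]} (hB : expand R p B = B ^ p)
    (t : ℕ) : expand R (p ^ t) B = B ^ p ^ t := by
  induction t with
  | zero => simp
  | succ t ih => rw [pow_succ', expand_mul, ih, map_pow, hB, ← pow_mul]

/-- The iterates of the Cartier action on the numerators over a power of `Q` are eventually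
periodic, with preperiod and period controlled by a multiple of `Q` modulo `p`. -/
theorem iterate_contract_eventually_periodic [hp : Fact p.Prime] (hα : 1 ≤ α) {m s b : ℕ}
    (hm : 1 ≤ m) {Q : (ZMod (p ^ α))[X]}
    (hQ : Q.map (redModP hα) ∣ (X ^ p ^ m - X) ^ p ^ s) (hb : b < p ^ s)
    {U : (ZMod (p ^ α))[X]} (hU : U.natDegree ≤ b * p ^ (α - 1)) :
    (fun U => contract p (U * (Q ^ p ^ (α - 1)) ^ (p - 1)))^[m + (m + (s + 2 * (α - 1)))] U =
      (fun U => contract p (U * (Q ^ p ^ (α - 1)) ^ (p - 1)))^[m + (s + 2 * (α - 1))] U := by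
  have : Nontrivial (ZMod (p ^ α)) :=
    ZMod.nontrivial_iff.2 (Nat.one_lt_pow (by omega) hp.out.one_lt).ne'
  have h1m : 1 < p ^ m := Nat.one_lt_pow (by omega) hp.out.one_lt
  have hp0 := hp.out.ne_zero
  set T := s + 2 * (α - 1) with hT
  set B := Q ^ p ^ (α - 1) with hBdef
  have hB : expand _ p B = B ^ p := expand_pow_eq_univariate hα Q
  obtain ⟨W, hWdeg, hW⟩ := exists_pow_mul_eq_X_pow_sub_X_pow hα hm hQ
  rw [← hT, ← hBdef] at hW
  rw [← hT] at hWdeg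
  set H : (ZMod (p ^ α))[X] := X ^ p ^ m - X with hH
  have hHmonic : H.Monic := by
    have := (natDegree_X_pow_sub_X_pow (R := ZMod (p ^ α)) h1m).1
    rwa [pow_one] at this
  have hHT : expand _ (p ^ T) H = B * W := by
    rw [hW, hH, map_sub, map_pow, expand_X, ← pow_mul, ← pow_add]
  have hne (t : ℕ) : p ^ t ≠ 0 := pow_ne_zero t hp0
  have hpt (t : ℕ) : p ^ t - 1 + 1 = p ^ t :=
    Nat.sub_add_cancel (Nat.one_le_iff_ne_zero.2 (hne t))
  set μ := fun U : (ZMod (p ^ α))[X] => contract p (U * B ^ (p - 1)) with hμ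
  obtain ⟨n, hn⟩ : ∃ n, p ^ m = n + 1 := ⟨p ^ m - 1, (hpt m).symm⟩
  have hn1 : 1 ≤ n := by omega
  -- Denominators cleared: `U / B = W * U / expand (p ^ T) H`, so `T` steps give a fraction over
  -- `H`.
  have step1 : H * μ^[T] U = B * contract (p ^ T) (W * U) := by
    rw [iterate_contract hp0 hB, ← contract_expand_mul (hne T), hHT, ← contract_expand_mul (hne T),
      expand_pow_pow hB]
    congr 1
    conv_rhs => rw [← hpt T, pow_succ]
    ring
  -- Since `H` divides `expand (p ^ m) H`, a block of `m` steps keeps the denominator `H`.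
  have step2 : ∀ U V : (ZMod (p ^ α))[X], H * U = B * V →
      H * μ^[m] U = B * contract (n + 1) (geomFactor _ n * V) := by
    intro U V hUV
    have hHm : expand _ (p ^ m) H = H * geomFactor _ n := by
      rw [hH, hn, sub_mul_geomFactor]
    rw [iterate_contract hp0 hB, ← contract_expand_mul (hne m), hHm, ← hn,
      ← contract_expand_mul (hne m), expand_pow_pow hB]
    congr 1
    calc _ = geomFactor _ n * (H * U) * B ^ (p ^ m - 1) := by ring
      _ = _ := by
        rw [hUV]
        conv_rhs => rw [← hpt m, pow_succ]
        ring
  have hdeg : (contract (p ^ T) (W * U)).natDegree ≤ n + 1 := by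
    refine natDegree_le_iff_coeff_eq_zero.2 fun k hk => ?_
    rw [coeff_contract (hne T)]
    refine coeff_eq_zero_of_natDegree_lt ?_
    refine natDegree_mul_le.trans_lt ?_
    have hlt : b * p ^ (α - 1) < p ^ T := by
      calc _ < p ^ s * p ^ (α - 1) := Nat.mul_lt_mul_of_pos_right hb (Nat.pow_pos hp.out.pos)
        _ ≤ _ := by rw [← pow_add]; exact Nat.pow_le_pow_right hp.out.pos (by omega)
    have h2 := Nat.mul_le_mul_right (p ^ T) (Nat.succ_le_of_lt hk)
    have h3 : p ^ (T + m) = (n + 1) * p ^ T := by rw [pow_add, hn, mul_comm]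
    rw [Nat.succ_mul] at h2
    omega
  -- One block of `m` steps yields a numerator without constant term and of degree at most `p ^ m`,
  -- which the second block fixes. The monic `H` can then be cancelled.
  have step3 := step2 _ _ step1
  have step4 := step2 _ _ step3
  rw [contract_geomFactor_mul_eq_self hn1 (natDegree_contract_geomFactor_mul hdeg)
    (coeff_zero_contract_geomFactor_mul hn1 _), ← step3] at step4
  have := hHmonic.isRegular.left step4
  rw [Function.iterate_add_apply _ m (m + T), Function.iterate_add_apply _ m T]
  exact this

end Periodic

/-! ### Splitting degrees over `ℤ/p`. -/

section FrobeniusPeriod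

open Polynomial UniqueFactorizationMonoid

/-- A nonzero polynomial over `ℤ/p` of degree at most `n` divides a power of `X ^ p ^ m - X` for
some `m` of subexponential size in `n`. -/
theorem exists_dvd_X_pow_sub_X_pow {p : ℕ} [hp : Fact p.Prime] {n : ℕ} {Q : (ZMod p)[X]}
    (hQ : Q ≠ 0) (hn : Q.natDegree ≤ n) :
    ∃ m, 1 ≤ m ∧ m ≤ (n + 1) ^ Nat.sqrt (2 * n) ∧ Q ∣ (X ^ p ^ m - X) ^ n := by
  classical
  set F := normalizedFactors Q with hF
  have hirr : ∀ π ∈ F, Irreducible π := fun π hπ => irreducible_of_normalized_factor π hπ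
  have hassoc : Associated F.prod Q := prod_normalizedFactors hQ
  have hsum : (F.map natDegree).sum ≤ n := by
    rw [← natDegree_multiset_prod F (fun h => (hirr 0 h).ne_zero rfl)]
    rwa [natDegree_eq_of_degree_eq (degree_eq_degree_of_associated hassoc)]
  set D := (F.map natDegree).toFinset with hD
  have hpos : ∀ δ ∈ D, 1 ≤ δ := by
    intro δ hδ
    obtain ⟨π, hπ, rfl⟩ := Multiset.mem_map.1 (Multiset.mem_toFinset.1 hδ)
    exact (hirr π hπ).natDegree_pos
  have hDsum : ∑ δ ∈ D, δ ≤ n := by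
    refine le_trans ?_ hsum
    have : D.val ≤ F.map natDegree := Multiset.dedup_le _
    rw [Finset.sum_eq_multiset_sum, Multiset.map_id']
    obtain ⟨t, ht⟩ := Multiset.le_iff_exists_add.1 this
    rw [ht, Multiset.sum_add]
    exact Nat.le_add_right _ _
  -- Distinct positive integers: `1 + 2 + … + D.card ≤ n`.
  have hcard : D.card ≤ Nat.sqrt (2 * n) := by
    rw [Nat.le_sqrt]
    have h1 : ∑ i ∈ Finset.range D.card, (i + 1) ≤ ∑ δ ∈ D, δ := by
      have h2 := Finset.sum_range_le_sum (s := D.map Nat.castEmbedding) (c := 1) (by simpa using hpos)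
      rw [Finset.card_map, Finset.sum_map] at h2
      zify
      refine le_trans (le_of_eq ?_) h2
      exact Finset.sum_congr rfl fun i _ => add_comm _ _
    have h2 := Finset.sum_range_id_mul_two (D.card + 1)
    rw [Finset.sum_range_succ'] at h2
    simp only [Nat.add_sub_cancel, add_zero] at h2
    nlinarith
  -- The product of the distinct degrees is a multiple of each of them, so every irreducible factor
  -- divides `X ^ p ^ m - X`; the outer power pays for multiplicities.
  refine ⟨∏ δ ∈ D, δ, Nat.one_le_iff_ne_zero.2 (Finset.prod_ne_zero_iff.2 fun δ hδ => ?_), ?_, ?_⟩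
  · exact Nat.one_le_iff_ne_zero.1 (hpos δ hδ)
  · calc ∏ δ ∈ D, δ ≤ ∏ δ ∈ D, (n + 1) := Finset.prod_le_prod' fun δ hδ =>
          ((Finset.single_le_sum (fun _ _ => Nat.zero_le _) hδ).trans hDsum).trans n.le_succ
      _ = (n + 1) ^ D.card := Finset.prod_const _
      _ ≤ _ := Nat.pow_le_pow_right n.succ_pos hcard
  · have h1 : F.prod ∣ (X ^ p ^ (∏ δ ∈ D, δ) - X) ^ F.card := by
      rw [← Multiset.prod_replicate, ← Multiset.map_const']
      conv_lhs => rw [← Multiset.map_id' F]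
      refine Multiset.prod_dvd_prod_of_dvd _ _ fun π hπ => ?_
      have := (hirr π hπ).natDegree_dvd_iff_dvd_X_pow_card_pow_sub_X (n := ∏ δ ∈ D, δ)
      rw [Nat.card_zmod] at this
      exact this.1 (Finset.dvd_prod_of_mem _
        (Multiset.mem_toFinset.2 (Multiset.mem_map_of_mem _ hπ)))
    refine hassoc.dvd'.trans (h1.trans (pow_dvd_pow _ (le_trans ?_ hsum)))
    have := Multiset.card_nsmul_le_sum (s := F.map natDegree) (a := 1) fun x hx =>
      hpos x (Multiset.mem_toFinset.2 hx)
    simpa using this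

end FrobeniusPeriod

/-! ### Furstenberg's formula for the coefficients of the root. -/

section Initial

open Polynomial

variable {p α : ℕ}

/-- Extraction of a root `f` of a polynomial from the powers of the polynomial, in a ring where
`f ^ p ^ t = 0`. -/
lemma coeff_X_sq_mul_derivative_mul_pow [hp : Fact p.Prime] (hα : 1 ≤ α) {R : Type*} [CommRing R]
    [Algebra (ZMod (p ^ α)) R] {x f : R} {t : ℕ} (hx : x ^ p ^ t = 0) (hf : x ∣ f)
    {G r : R[X]} {G₀ : (ZMod (p ^ α))[X]}
    (hG : G = G₀.map (algebraMap _ R) + C x * r) :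
    (X ^ 2 * derivative ((X - C f) * G) *
      ((X - C f) * G) ^ (p ^ t * p ^ (α - 1) - 1)).coeff (p ^ t * p ^ (α - 1)) =
        algebraMap _ R (G₀.coeff 0) ^ (p ^ t * p ^ (α - 1)) * f := by
  set M := p ^ t with hM
  set q := p ^ (α - 1) with hq
  have hM0 : 0 < M := Nat.pow_pos hp.out.pos
  have hq0 : 0 < q := Nat.pow_pos hp.out.pos
  obtain ⟨N, hN⟩ : ∃ N, M * q = N + 1 := ⟨M * q - 1, (Nat.sub_add_cancel (Nat.mul_pos hM0 hq0)).symm⟩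
  have hMN : M ≤ N + 1 := hN ▸ Nat.le_mul_of_pos_right M hq0
  have hfM {k : ℕ} (hk : M ≤ k) : f ^ k = 0 := by
    obtain ⟨g, rfl⟩ := hf
    rw [mul_pow, ← Nat.sub_add_cancel hk, pow_add, hx, mul_zero, zero_mul]
  set L : R[X] := X - C f with hL
  have hLpow : L ^ (N + 1) = X ^ (N + 1) := by
    rw [← hN, pow_mul, pow_mul]
    refine pow_pow_eq_of_dvd_sub hα ?_
    obtain ⟨u, hu⟩ := exists_add_pow_prime_pow_eq hp.out (X : R[X]) (-C f) t
    rw [← sub_eq_add_neg, ← hM, ← C_neg, ← C_pow, neg_pow, hfM le_rfl, mul_zero, C_0,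
      add_zero] at hu
    exact ⟨X * C (-f) * u, by rw [hu]; ring⟩
  have hGpow : G ^ (N + 1) = (expand _ M (G₀ ^ q)).map (algebraMap _ R) := by
    rw [hM, expand_pow_pow (expand_pow_eq_univariate hα G₀), ← pow_mul, ← hM, mul_comm q,
      Polynomial.map_pow, ← hN, pow_mul, pow_mul]
    refine pow_pow_eq_of_dvd_sub hα ?_
    obtain ⟨u, hu⟩ := exists_add_pow_prime_pow_eq hp.out (G₀.map (algebraMap _ R)) (C x * r) t
    rw [mul_pow, ← C_pow, ← hM, hx, C_0, zero_mul, add_zero, ← hG] at hu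
    exact ⟨_, by rw [hu, add_sub_cancel_left, mul_assoc, mul_assoc, mul_assoc]⟩
  have hLsum : L ^ N = ∑ i ∈ Finset.range (N + 1), X ^ i * C f ^ (N - i) := by
    have h1 := geom_sum₂_mul (X : R[X]) (C f) (N + 1)
    rw [← C_pow, hfM hMN, C_0, sub_zero, ← hLpow, pow_succ] at h1
    exact ((monic_X_sub_C f).isRegular.right h1).symm
  have hcoeff (a : ℕ) (ha : a ≤ N + 1) :
      (X ^ 2 * L ^ N).coeff a = if 2 ≤ a then f ^ (N + 2 - a) else 0 := by
    rw [coeff_X_pow_mul']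
    split_ifs with h2
    · rw [hLsum, finsetSum_coeff, Finset.sum_eq_single (a - 2)]
      · rw [← C_pow, coeff_mul_C, coeff_X_pow_self, one_mul]
        congr 1
        omega
      · intro b _ hb
        rw [← C_pow, coeff_mul_C, coeff_X_pow, if_neg (Ne.symm hb), zero_mul]
      · intro h
        exact absurd (Finset.mem_range.2 (by omega)) h
    · rfl
  -- The term with `derivative G` starts in degree `N + 3` and is not seen in degree `N + 1`. The
  -- factor `X ^ 2` puts `f ^ 1` of `L ^ N` into that degree.
  have hsplit : X ^ 2 * derivative (L * G) * (L * G) ^ N =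
      X ^ 2 * L ^ N * G ^ (N + 1) + X ^ (N + 1 + 2) * (G ^ N * derivative G) := by
    rw [pow_add X (N + 1), ← hLpow, derivative_mul, hL, derivative_X_sub_C, mul_pow]
    ring
  rw [hN, Nat.add_sub_cancel, hsplit, coeff_add, coeff_X_pow_mul', if_neg (by omega), add_zero,
    coeff_mul, Finset.sum_eq_single (N + 1, 0)]
  · simp only
    rw [hcoeff _ le_rfl, hGpow, coeff_map, coeff_expand hM0, if_pos (dvd_zero _), Nat.zero_div,
      coeff_zero_eq_eval_zero, eval_pow, ← coeff_zero_eq_eval_zero, map_pow]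
    have hpow : algebraMap (ZMod (p ^ α)) R (G₀.coeff 0) ^ (N + 1) =
        algebraMap (ZMod (p ^ α)) R (G₀.coeff 0) ^ q := by
      have h1 := congrArg (fun g => g.coeff 0) (expand_pow_pow (expand_pow_eq_univariate hα
        (C (G₀.coeff 0))) t)
      rw [← C_pow, expand_C, ← C_pow, coeff_C_zero, coeff_C_zero, ← pow_mul, ← hM, ← hq,
        mul_comm q, hN] at h1
      rw [← map_pow, ← map_pow, h1]
    rw [hpow, mul_comm]
    congr 1
    split_ifs with h2
    · rw [show N + 2 - (N + 1) = 1 by omega, pow_one]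
    -- Degenerate case `N = 0`, in which `f = f ^ M = 0`.
    · have : M = 1 := by omega
      rw [← pow_one f, hfM this.le]
  · rintro ⟨a, b⟩ hab hne
    rw [Finset.HasAntidiagonal.mem_antidiagonal] at hab
    simp only at hab ⊢
    have hb : b ≠ 0 := by
      rintro rfl
      exact hne (by rw [← hab, add_zero])
    rw [hGpow, coeff_map, coeff_expand hM0]
    -- A nonzero exponent in the expanded factor is at least `M`, and leaves a power of `f` that
    -- vanishes.
    split_ifs with hd
    · have := Nat.le_of_dvd (Nat.pos_of_ne_zero hb) hd
      rw [hcoeff a (by omega), hfM (by omega)]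
      simp
    · rw [map_zero, mul_zero]
  · intro h
    exact absurd (Finset.HasAntidiagonal.mem_antidiagonal.2 (add_zero (N + 1))) h

variable {A : Type*} [CommRing A]

/-- The embedding of `A[x, y]` in the polynomials in `y` over the power series in `x`. -/
noncomputable def toSeriesPolynomial : MvPolynomial (Fin 2) A →ₐ[A] (PowerSeries A)[X] :=
  MvPolynomial.aeval ![C PowerSeries.X, X]

lemma coeff_coeff_toSeriesPolynomial (S : MvPolynomial (Fin 2) A) (i j : ℕ) :
    PowerSeries.coeff i ((toSeriesPolynomial S).coeff j) =
      S.coeff (Finsupp.single 0 i + Finsupp.single 1 j) := by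
  induction S using MvPolynomial.induction_on' with
  | add f g hf hg => rw [map_add, coeff_add, map_add, MvPolynomial.coeff_add, hf, hg]
  | monomial n r =>
    have h : toSeriesPolynomial (MvPolynomial.monomial n r) =
        C (PowerSeries.C r * PowerSeries.X ^ n 0) * X ^ n 1 := by
      rw [toSeriesPolynomial, MvPolynomial.aeval_monomial, Finsupp.prod_fintype _ _ (by simp),
        Fin.prod_univ_two, Polynomial.algebraMap_apply]
      simp only [Matrix.cons_val_zero, Matrix.cons_val_one, map_mul, map_pow, mul_assoc]
      rfl
    rw [h, coeff_C_mul_X_pow, MvPolynomial.coeff_monomial]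
    have hiff : n = Finsupp.single 0 i + Finsupp.single 1 j ↔ j = n 1 ∧ i = n 0 := by
      constructor
      · rintro rfl
        simp
      · rintro ⟨rfl, rfl⟩
        ext l
        fin_cases l <;> simp
    rw [if_congr hiff rfl rfl]
    split_ifs with h1 h2 h2
    · rw [PowerSeries.coeff_C_mul, PowerSeries.coeff_X_pow, if_pos h2.2, mul_one]
    · rw [PowerSeries.coeff_C_mul, PowerSeries.coeff_X_pow, if_neg fun h3 => h2 ⟨h1, h3⟩, mul_zero]
    · exact absurd h2.1 h1
    · rw [map_zero]

lemma toSeriesPolynomial_pderiv (S : MvPolynomial (Fin 2) A) :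
    toSeriesPolynomial (MvPolynomial.pderiv 1 S) = derivative (toSeriesPolynomial S) := by
  induction S using MvPolynomial.induction_on with
  | C a =>
    rw [MvPolynomial.pderiv_C, map_zero, ← MvPolynomial.algebraMap_eq, AlgHom.commutes,
      Polynomial.algebraMap_apply, derivative_C]
  | add f g hf hg => rw [map_add, map_add, map_add, hf, hg, derivative_add]
  | mul_X f i hf =>
    rw [Derivation.leibniz, smul_eq_mul, smul_eq_mul, map_add, map_mul, map_mul, hf, map_mul,
      derivative_mul]
    fin_cases i <;> simp [toSeriesPolynomial, MvPolynomial.pderiv_X, mul_comm, add_comm]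

lemma eval_toSeriesPolynomial (S : MvPolynomial (Fin 2) A) (F : PowerSeries A) :
    eval F (toSeriesPolynomial S) = MvPolynomial.aeval ![PowerSeries.X, F] S := by
  have : ((aeval F : (PowerSeries A)[X] →ₐ[PowerSeries A] PowerSeries A).restrictScalars A).comp
      toSeriesPolynomial = MvPolynomial.aeval ![PowerSeries.X, F] := by
    refine MvPolynomial.algHom_ext fun i => ?_
    fin_cases i <;> simp [toSeriesPolynomial]
  rw [← this]
  simp [coe_aeval_eq_eval]

/-- The coefficients of a power series root, from the powers of the polynomial. -/
theorem coeff_X_sq_mul_pderiv_mul_pow [hp : Fact p.Prime] (hα : 1 ≤ α)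
    {P : MvPolynomial (Fin 2) (ZMod (p ^ α))} {F : PowerSeries (ZMod (p ^ α))}
    (hF0 : PowerSeries.constantCoeff F = 0)
    (hPF : MvPolynomial.aeval ![PowerSeries.X, F] P = 0) {n t : ℕ} (hn : n < p ^ t) :
    (MvPolynomial.X 1 ^ 2 * MvPolynomial.pderiv 1 P * P ^ (p ^ t * p ^ (α - 1) - 1)).coeff
      (Finsupp.single 0 n + Finsupp.single 1 (p ^ t * p ^ (α - 1))) =
        P.coeff (Finsupp.single 1 1) ^ (p ^ t * p ^ (α - 1)) * PowerSeries.coeff n F := by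
  have hroot : (toSeriesPolynomial P).IsRoot F := by
    rw [IsRoot.def, eval_toSeriesPolynomial, hPF]
  obtain ⟨G, hG⟩ := dvd_iff_isRoot.2 hroot
  -- Truncation at `X ^ p ^ t` makes the root nilpotent and, as `n < p ^ t`, keeps the coefficient
  -- sought.
  let I := Ideal.span {(PowerSeries.X : PowerSeries (ZMod (p ^ α))) ^ p ^ t}
  let π := Ideal.Quotient.mk I
  set G₀ := G.map (PowerSeries.constantCoeff (R := ZMod (p ^ α))) with hG₀
  obtain ⟨r, hr⟩ : (C PowerSeries.X : (PowerSeries (ZMod (p ^ α)))[X]) ∣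
      G - G₀.map PowerSeries.C := by
    rw [C_dvd_iff_dvd_coeff]
    intro i
    rw [PowerSeries.X_dvd_iff, coeff_sub, coeff_map, hG₀, coeff_map, map_sub,
      PowerSeries.constantCoeff_C, sub_self]
  have hmap : G.map π = G₀.map (algebraMap _ (PowerSeries (ZMod (p ^ α)) ⧸ I)) +
      C (π PowerSeries.X) * r.map π := by
    rw [← sub_add_cancel G (G₀.map PowerSeries.C), hr, Polynomial.map_add, Polynomial.map_mul,
      map_C, add_comm, Polynomial.map_map]
    rfl
  have hx : π PowerSeries.X ^ p ^ t = 0 := by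
    rw [← map_pow]
    exact Ideal.Quotient.eq_zero_iff_mem.2 (Ideal.mem_span_singleton_self _)
  have key := coeff_X_sq_mul_derivative_mul_pow hα hx
    (map_dvd π (PowerSeries.X_dvd_iff.2 hF0)) hmap
  have hc : P.coeff (Finsupp.single 1 1) = G₀.coeff 0 := by
    have h1 := coeff_coeff_toSeriesPolynomial P 0 1
    rw [Finsupp.single_zero, zero_add, hG] at h1
    rw [← h1, PowerSeries.coeff_zero_eq_constantCoeff, sub_mul, coeff_sub, coeff_X_mul, coeff_C_mul,
      map_sub, map_mul, hF0, zero_mul, sub_zero, hG₀, coeff_map]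
  have h2 : π ((toSeriesPolynomial (MvPolynomial.X 1 ^ 2 * MvPolynomial.pderiv 1 P *
      P ^ (p ^ t * p ^ (α - 1) - 1))).coeff (p ^ t * p ^ (α - 1))) =
      π (PowerSeries.C (P.coeff (Finsupp.single 1 1) ^ (p ^ t * p ^ (α - 1))) * F) := by
    rw [map_mul, map_mul, map_pow, map_pow, toSeriesPolynomial_pderiv, hG, ← coeff_map,
      Polynomial.map_mul, Polynomial.map_mul, Polynomial.map_pow, Polynomial.map_pow,
      ← derivative_map, Polynomial.map_mul, Polynomial.map_sub, map_C, map_X, map_mul π, hc]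
    have hX : (toSeriesPolynomial (MvPolynomial.X 1 : MvPolynomial (Fin 2) (ZMod (p ^ α)))).map π =
        X := by
      simp [toSeriesPolynomial]
    rw [hX, key, map_pow]
    rfl
  have h3 : (PowerSeries.X : PowerSeries (ZMod (p ^ α))) ^ p ^ t ∣ _ :=
    Ideal.mem_span_singleton.1 (Ideal.Quotient.eq.1 h2)
  have h4 := PowerSeries.X_pow_dvd_iff.1 h3 n hn
  rw [map_sub, sub_eq_zero, coeff_coeff_toSeriesPolynomial, PowerSeries.coeff_C_mul] at h4
  exact h4

end Initial

/-! ### Counting lattice points. -/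

section Region

/-- The lattice points of the rectangle `[i₀, i₁) × [j₀, j₁)` with coordinate sum at least `e`. -/
noncomputable def region (i₀ i₁ j₀ j₁ e : ℕ) : Finset (Fin 2 →₀ ℕ) :=
  ((Finset.Ico i₀ i₁).sigma fun i => (Finset.Ico j₀ j₁).filter fun j => e ≤ i + j).image
    fun x => Finsupp.single 0 x.1 + Finsupp.single 1 x.2

lemma mem_region {i₀ i₁ j₀ j₁ e : ℕ} {m : Fin 2 →₀ ℕ} : m ∈ region i₀ i₁ j₀ j₁ e ↔
    (i₀ ≤ m 0 ∧ m 0 < i₁) ∧ (j₀ ≤ m 1 ∧ m 1 < j₁) ∧ e ≤ m 0 + m 1 := by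
  simp only [region, Finset.mem_image, Finset.mem_sigma, Finset.mem_Ico, Finset.mem_filter]
  constructor
  · rintro ⟨⟨i, j⟩, h, rfl⟩
    simpa using h
  · intro h
    refine ⟨⟨m 0, m 1⟩, h, ?_⟩
    ext i
    fin_cases i <;> simp

/-- Column `i` loses `e - i₀ - 1 - i` of its `b` points, truncated at `0`; these losses fill a
triangle with `(e - i₀) * (e - i₀ - 1) / 2` points. -/
lemma card_region_le {i₀ a b e : ℕ} (ha : e ≤ i₀ + a + 1) (hb : e ≤ i₀ + b + 1) :
    (region i₀ (i₀ + a) 1 (1 + b) e).card * 2 + (e - i₀) * (e - i₀ - 1) ≤ 2 * (a * b) := by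
  have h1 : (region i₀ (i₀ + a) 1 (1 + b) e).card ≤
      ∑ i ∈ Finset.range a, (b - (e - i₀ - 1 - i)) := by
    refine Finset.card_image_le.trans ?_
    rw [Finset.card_sigma, Finset.sum_Ico_eq_sum_range, Nat.add_sub_cancel_left]
    refine Finset.sum_le_sum fun i _ => ?_
    calc _ ≤ (Finset.Ico (max 1 (e - (i₀ + i))) (1 + b)).card := by
          refine Finset.card_le_card fun j hj => ?_
          simp only [Finset.mem_filter, Finset.mem_Ico] at hj ⊢
          omega
      _ ≤ _ := by rw [Nat.card_Ico]; omega
  have h2 : ∑ i ∈ Finset.range a, (b - (e - i₀ - 1 - i)) +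
      ∑ i ∈ Finset.range a, (e - i₀ - 1 - i) = a * b := by
    rw [← Finset.sum_add_distrib]
    calc _ = ∑ i ∈ Finset.range a, b := Finset.sum_congr rfl fun i _ => by omega
      _ = _ := by rw [Finset.sum_const, Finset.card_range, smul_eq_mul]
  have h3 : (e - i₀) * (e - i₀ - 1) ≤ (∑ i ∈ Finset.range a, (e - i₀ - 1 - i)) * 2 := by
    rw [← Finset.sum_range_id_mul_two, ← Finset.sum_range_reflect]
    refine Nat.mul_le_mul_right 2 ?_
    rcases Nat.eq_zero_or_pos (e - i₀) with h0 | h0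
    · simp [h0]
    obtain ⟨k, hk⟩ : ∃ k, e - i₀ = k + 1 := ⟨e - i₀ - 1, by omega⟩
    rw [hk, Finset.sum_range_succ]
    simp only [Nat.add_sub_cancel, Nat.sub_self, add_zero]
    exact Finset.sum_le_sum_of_subset (Finset.range_mono (by omega))
  omega

end Region

/-! ### Effect of one digit on the regions. -/

section Steps

variable {h d p r : ℕ}

lemma add_mem_region {i₀ a b e h d : ℕ} {m n : Fin 2 →₀ ℕ}
    (hm : m ∈ region i₀ (h * e + a) 1 (d * e + b) e) (hn : n ∈ newton h d 1) :
    m + n ∈ region i₀ (h * (e + 1) + a) 1 (d * (e + 1) + b) (e + 1) := by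
  rw [mem_region] at hm ⊢
  simp only [newton, Set.mem_ofPred_eq, Finsupp.add_apply, mul_add, mul_one] at *
  omega

/-- `c'` and `c` tell whether the right edge belongs to the region before and after. It survives
only the digit `0`: subtracting `r ≠ 0` before the division by `p` falls short of it. The extra row
`d * e + 1` disappears because `1 < p`, and the bound on the coordinate sum survives because `r <
p`. -/
lemma mem_region_of_smul_eq (hp : 2 ≤ p) (hr : r < p) {c c' e j : ℕ} (hc : c ≤ 1)
    (hc' : c' ≤ 1) (hcc : c' ≤ c ∨ r ≠ 0) {m n m' : Fin 2 →₀ ℕ}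
    (hm : m ∈ region 0 (h * e + c') 1 (d * e + 2) e)
    (hn : n ∈ newton h d ((p - 1) * e + p * j))
    (hmn : p • m' + Finsupp.single 0 r = m + n) :
    m' ∈ region 0 (h * (e + j) + c) 1 (d * (e + j) + 1) (e + j) := by
  obtain ⟨p, rfl⟩ : ∃ k, p = k + 1 := ⟨p - 1, by omega⟩
  have h0 : (p + 1) * m' 0 + r = m 0 + n 0 := by simpa using DFunLike.congr_fun hmn 0
  have h1 : (p + 1) * m' 1 = m 1 + n 1 := by simpa using DFunLike.congr_fun hmn 1
  rw [mem_region] at hm ⊢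
  simp only [newton, Set.mem_ofPred_eq, Nat.add_sub_cancel] at hn
  obtain ⟨⟨-, hm0⟩, ⟨hm1, hm2⟩, hm3⟩ := hm
  obtain ⟨hn0, hn1, hn2⟩ := hn
  refine ⟨⟨Nat.zero_le _, ?_⟩, ⟨?_, ?_⟩, ?_⟩
  · by_contra hcon
    have := Nat.mul_le_mul_left (p + 1) (not_lt.1 hcon)
    have e1 : h * (p * e + (p + 1) * j) + h * e = (p + 1) * (h * (e + j)) := by ring
    rw [mul_add (p + 1)] at this
    obtain rfl | rfl : c = 0 ∨ c = 1 := by omega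
    · have : r ≠ 0 ∨ c' = 0 := by omega
      omega
    · omega
  · by_contra hcon
    have : m' 1 = 0 := by omega
    rw [this] at h1
    omega
  · by_contra hcon
    have := Nat.mul_le_mul_left (p + 1) (not_lt.1 hcon)
    have e1 : d * (p * e + (p + 1) * j) + d * e = (p + 1) * (d * (e + j)) := by ring
    rw [mul_add (p + 1)] at this
    omega
  · by_contra hcon
    have := Nat.mul_le_mul_left (p + 1) (Nat.succ_le_of_lt (not_le.1 hcon))
    have e1 : p * e + (p + 1) * j + e = (p + 1) * (e + j) := by ring
    rw [Nat.succ_eq_add_one, mul_add, mul_add] at this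
    omega

end Steps

/-! ### State spaces and their faces. -/

section States

open MvPolynomial (restrictSupport)

variable {p α h d : ℕ} {P : MvPolynomial (Fin 2) (ZMod (p ^ α))}

/-- The left, right and upper edges of the rectangle `[0, h] × [0, d]`, in the form of arguments
of `face`. -/
def edges (h d : ℕ) : Finset (Fin 2 × ℕ) := {(0, 0), (0, h), (1, d)}

/-- The transition on numerators over `P ^ p ^ (α - 1)` that belongs to the digit `i`. -/
noncomputable def cartierStep [NeZero p] (P : MvPolynomial (Fin 2) (ZMod (p ^ α)))
    (S : MvPolynomial (Fin 2) (ZMod (p ^ α))) (i : Fin p) : MvPolynomial (Fin 2) (ZMod (p ^ α)) :=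
  cartier p i (S * (P ^ p ^ (α - 1)) ^ (p - 1))

/-- The ladder of the rectangles `[0, h * e + a) × [1, d * e + b)` without the points of
coordinate sum less than `e`. -/
noncomputable def boxLadder (P : MvPolynomial (Fin 2) (ZMod (p ^ α))) (h d a b : ℕ) :
    Submodule (ZMod (p ^ α)) (MvPolynomial (Fin 2) (ZMod (p ^ α))) :=
  ladder P (fun e => (region 0 (h * e + a) 1 (d * e + b) e : Set (Fin 2 →₀ ℕ))) 0

lemma boxLadder_mono {a b a' b' : ℕ} (ha : a ≤ a') (hb : b ≤ b') :
    boxLadder P h d a b ≤ boxLadder P h d a' b' :=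
  ladder_mono fun e m hm => by
    have hm := mem_region.1 (Finset.mem_coe.1 hm)
    exact Finset.mem_coe.2 (mem_region.2 (by omega))

variable [hp : Fact p.Prime]

lemma cartierStep_mem_boxLadder (hα : 1 ≤ α) (hP : P ∈ restrictSupport _ (newton h d 1))
    {c c' : ℕ} (hc : c ≤ 1) (hc' : c' ≤ 1) {i : Fin p} (hcc : c' ≤ c ∨ (i : ℕ) ≠ 0)
    {S : MvPolynomial (Fin 2) (ZMod (p ^ α))} (hS : S ∈ boxLadder P h d c' 2) :
    cartierStep P S i ∈ boxLadder P h d c 1 := by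
  refine cartier_mem_ladder hα i.2 hP (fun e j m hm n hn m' hmn => ?_) hS
  exact Finset.mem_coe.2
    (mem_region_of_smul_eq hp.out.two_le i.2 hc hc' hcc (Finset.mem_coe.1 hm) hn hmn)

lemma boxLadder_le_newton (hα : 1 ≤ α) (hP : P ∈ restrictSupport _ (newton h d 1)) :
    boxLadder P h d 1 1 ≤ restrictSupport _ (newton h d (p ^ (α - 1))) := by
  have hq := le_pow_sub_one hp.out hα
  set q := p ^ (α - 1)
  have hPk (k) : P ^ (q - 1 - k) ∈ restrictSupport _ (newton h d (q - 1 - k)) := by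
    simpa using pow_mem_newton hP (q - 1 - k)
  refine ladder_le fun k _ T hT => ?_
  by_cases hk : α ≤ k
  · rw [natCast_pow_eq_zero hk, zero_mul, zero_mul]
    exact Submodule.zero_mem _
  rw [mul_assoc, ← Nat.cast_pow, ← nsmul_eq_mul]
  refine Submodule.smul_of_tower_mem _ _ ?_
  have hT' : T ∈ restrictSupport _ (newton h d (k + 1)) := by
    refine MvPolynomial.restrictSupport_mono _ (fun v hv => ?_) hT
    have hv := mem_region.1 (Finset.mem_coe.1 hv)
    simp only [newton, Set.mem_ofPred_eq]
    omega
  have := mul_mem_newton (hPk k) hT'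
  rwa [show q - 1 - k + (k + 1) = q by omega] at this

lemma newton_subset_faceDomain {ψ : Fin 2 × ℕ} (hψ : ψ ∈ edges h d) (e : ℕ) :
    newton h d e ⊆ faceDomain ψ.1 ψ.2 e := by
  intro m hm
  simp only [edges, Finset.mem_insert, Finset.mem_singleton] at hψ
  simp only [newton, faceDomain, Set.mem_ofPred_eq] at hm ⊢
  rcases hψ with rfl | rfl | rfl <;> simp [hm.1, hm.2.1]

lemma natDegree_face_le {A : Type*} [CommRing A] {e : ℕ} {S : MvPolynomial (Fin 2) A}
    (hS : S ∈ restrictSupport A (newton h d e)) (ψ : Fin 2 × ℕ) (c : ℕ) :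
    (face ψ.1 ψ.2 c S).natDegree ≤ (h + d) * e := by
  refine Polynomial.natDegree_le_iff_coeff_eq_zero.2 fun k hk => ?_
  rw [face, coeff_coeff_slice]
  refine coeff_eq_zero_of_mem_restrictSupport hS fun hmem => ?_
  simp only [newton, Set.mem_ofPred_eq] at hmem
  rw [add_mul] at hk
  obtain ⟨i, c₀⟩ := ψ
  fin_cases i
  · simp at hmem; omega
  · simp at hmem; omega

/-- For the digit `0`, faces commute with the Cartier operator, and they are multiplicative. So each
face evolves on its own, over a power of the face of `P`. -/
lemma face_cartierStep (hα : 1 ≤ α) (hP : P ∈ restrictSupport _ (newton h d 1))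
    {ψ : Fin 2 × ℕ} (hψ : ψ ∈ edges h d) {S : MvPolynomial (Fin 2) (ZMod (p ^ α))}
    (hS : S ∈ boxLadder P h d 1 1) {i : Fin p} (hi : (i : ℕ) = 0) :
    face ψ.1 ψ.2 (p ^ (α - 1)) (cartierStep P S i) =
      Polynomial.contract p (face ψ.1 ψ.2 (p ^ (α - 1)) S *
        (face ψ.1 ψ.2 1 P ^ p ^ (α - 1)) ^ (p - 1)) := by
  have hSN := MvPolynomial.restrictSupport_mono _ (newton_subset_faceDomain hψ _)
    (boxLadder_le_newton hα hP hS)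
  have hPN := MvPolynomial.restrictSupport_mono _ (newton_subset_faceDomain hψ _) hP
  have hPq := pow_mem_faceDomain hPN (p ^ (α - 1))
  rw [one_mul] at hPq
  have h1 := face_mul hSN (pow_mem_faceDomain hPq (p - 1))
  have h2 := face_pow hPN (p ^ (α - 1))
  rw [one_mul] at h2
  rw [face_pow hPq, h2] at h1
  rw [cartierStep, hi, face_cartier, ← h1]
  congr 2
  obtain ⟨k, hk⟩ : ∃ k, p = k + 1 := ⟨p - 1, by have := hp.out.pos; omega⟩
  rw [show p - 1 = k by omega]
  conv_lhs => rw [show p * p ^ (α - 1) = (k + 1) * p ^ (α - 1) by rw [← hk]]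
  ring

end States

/-! ### The path of zeros and the number of states. -/

section Orbit

lemma exists_lt_of_eventually_periodic {β : Type*} {φ : ℕ → β} {a m : ℕ} (hm : 1 ≤ m)
    (h : ∀ t, a ≤ t → φ (t + m) = φ t) (t : ℕ) : ∃ t' < a + m, φ t = φ t' := by
  induction t using Nat.strong_induction_on with
  | _ t ih =>
    by_cases ht : t < a + m
    · exact ⟨t, ht, rfl⟩
    · obtain ⟨t', ht', h'⟩ := ih (t - m) (by omega)
      refine ⟨t', ht', ?_⟩
      rw [← h', ← h (t - m) (by omega), Nat.sub_add_cancel (by omega)]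

open MvPolynomial (restrictSupport)

variable {p α h d : ℕ} [hp : Fact p.Prime] {P : MvPolynomial (Fin 2) (ZMod (p ^ α))}

lemma zero_iterate_mem (hα : 1 ≤ α) (hP : P ∈ restrictSupport _ (newton h d 1))
    {S : MvPolynomial (Fin 2) (ZMod (p ^ α))} (hS : S ∈ boxLadder P h d 1 1) {i : Fin p} (t : ℕ) :
    (fun S => cartierStep P S i)^[t] S ∈ boxLadder P h d 1 1 := by
  induction t with
  | zero => exact hS
  | succ t ih =>
    rw [Function.iterate_succ_apply']
    exact cartierStep_mem_boxLadder hα hP le_rfl le_rfl (Or.inl le_rfl)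
      (boxLadder_mono le_rfl one_le_two ih)

/-- The bound for the period of the faces under reading zeros. -/
def periodBound (n : ℕ) : ℕ := (n + 1) ^ Nat.sqrt (2 * n)

/-- Reading zeros, only few configurations of the faces occur. -/
lemma exists_face_eventually_periodic (hα : 1 ≤ α) (hP : P ∈ restrictSupport _ (newton h d 1))
    (hP0 : ∀ ψ ∈ edges h d, (face ψ.1 ψ.2 1 P).map (redModP hα) ≠ 0)
    {S : MvPolynomial (Fin 2) (ZMod (p ^ α))} (hS : S ∈ boxLadder P h d 1 1) {i : Fin p}
    (hi : (i : ℕ) = 0) : ∃ N ≤ 3 * (h + d) + 2 * (α - 1) + 2 * periodBound (3 * (h + d)),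
      ∀ t, ∃ t' < N, ∀ ψ ∈ edges h d,
        face ψ.1 ψ.2 (p ^ (α - 1)) ((fun S => cartierStep P S i)^[t] S) =
          face ψ.1 ψ.2 (p ^ (α - 1)) ((fun S => cartierStep P S i)^[t'] S) := by
  classical
  -- `n` bounds the degree of the product of the three faces, so a single `m` serves as a common
  -- period; it also serves as the exponent `s` of `iterate_contract_eventually_periodic`.
  set n := 3 * (h + d) with hn
  have hdegP (ψ : Fin 2 × ℕ) : (face ψ.1 ψ.2 1 P).natDegree ≤ h + d := by
    simpa using natDegree_face_le hP ψ 1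
  have hcard : (edges h d).card ≤ 3 := Finset.card_le_three
  obtain ⟨m, hm1, hmB, hdvd⟩ := exists_dvd_X_pow_sub_X_pow (n := n)
    (Q := ∏ ψ ∈ edges h d, (face ψ.1 ψ.2 1 P).map (redModP hα)) (Finset.prod_ne_zero_iff.2 hP0) (by
      refine (Polynomial.natDegree_prod_le _ _).trans ?_
      calc _ ≤ ∑ ψ ∈ edges h d, (h + d) := Finset.sum_le_sum fun ψ _ =>
            Polynomial.natDegree_map_le.trans (hdegP ψ)
        _ ≤ n := by
          rw [Finset.sum_const, smul_eq_mul]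
          exact Nat.mul_le_mul_right _ hcard)
  have hnp : n < p ^ n := n.lt_pow_self hp.out.one_lt
  have hdvd' (ψ) (hψ : ψ ∈ edges h d) : (face ψ.1 ψ.2 1 P).map (redModP hα) ∣
      (Polynomial.X ^ p ^ m - Polynomial.X) ^ p ^ n :=
    (Finset.dvd_prod_of_mem _ hψ).trans (hdvd.trans (pow_dvd_pow _ hnp.le))
  refine ⟨m + (n + 2 * (α - 1)) + m, ?_, fun t => ?_⟩
  · change m ≤ periodBound n at hmB
    omega
  set q := p ^ (α - 1)
  have hiter (ψ) (hψ : ψ ∈ edges h d) (t : ℕ) :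
      face ψ.1 ψ.2 q ((fun S => cartierStep P S i)^[t] S) =
        (fun U => Polynomial.contract p (U * (face ψ.1 ψ.2 1 P ^ q) ^ (p - 1)))^[t]
          (face ψ.1 ψ.2 q S) := by
    induction t with
    | zero => rfl
    | succ t ih =>
      rw [Function.iterate_succ_apply', Function.iterate_succ_apply', ← ih]
      exact face_cartierStep hα hP hψ (zero_iterate_mem hα hP hS t) hi
  have hper := exists_lt_of_eventually_periodic
    (φ := fun t (ψ : edges h d) => face ψ.1.1 ψ.1.2 q ((fun S => cartierStep P S i)^[t] S))
    (a := m + (n + 2 * (α - 1))) hm1 (fun t ht => by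
      funext ψ
      obtain ⟨k, rfl⟩ := Nat.exists_eq_add_of_le' ht
      rw [hiter _ ψ.2, hiter _ ψ.2, add_assoc, Function.iterate_add_apply,
        Function.iterate_add_apply _ k]
      congr 1
      rw [add_comm _ m]
      refine iterate_contract_eventually_periodic (b := h + d) hα hm1 (hdvd' _ ψ.2) (by omega) ?_
      exact natDegree_face_le (boxLadder_le_newton hα hP hS) _ _) t
  obtain ⟨t', ht', heq⟩ := hper
  exact ⟨t', ht', fun ψ hψ => congrFun heq ⟨ψ, hψ⟩⟩

lemma two_mul_card_region_rem {e : ℕ} (hh : 1 ≤ h) (hd : 1 ≤ d) (he : 1 ≤ e) :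
    (region 1 (h * e) 1 (d * e) e).card * 2 + (e - 1) * (e - 2) ≤
      2 * ((h * e - 1) * (d * e - 1)) := by
  have h1 : e ≤ h * e := Nat.le_mul_of_pos_left e hh
  have h2 : e ≤ d * e := Nat.le_mul_of_pos_left e hd
  have := card_region_le (i₀ := 1) (a := h * e - 1) (b := d * e - 1) (e := e) (by omega) (by omega)
  rwa [Nat.add_sub_cancel' (by omega), Nat.add_sub_cancel' (by omega)] at this

lemma two_mul_card_region_box {e : ℕ} (hh : 1 ≤ h) (hd : 1 ≤ d) :
    (region 0 (h * e) 1 (d * e + 1) e).card * 2 + e * (e - 1) ≤ 2 * ((h * e) * (d * e)) := by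
  have h1 : e ≤ h * e := Nat.le_mul_of_pos_left e hh
  have h2 : e ≤ d * e := Nat.le_mul_of_pos_left e hd
  have := card_region_le (i₀ := 0) (a := h * e) (b := d * e) (e := e) (by omega) (by omega)
  rwa [zero_add, add_comm 1, Nat.sub_zero] at this

/-- The number of states: the initial state, those that are reached by reading zeros, and the
others. -/
theorem exists_states (hα : 1 ≤ α) (hP : P ∈ restrictSupport _ (newton h d 1))
    (hP0 : ∀ ψ ∈ edges h d, (face ψ.1 ψ.2 1 P).map (redModP hα) ≠ 0)
    {S₀ : MvPolynomial (Fin 2) (ZMod (p ^ α))} (hS₀ : S₀ ∈ boxLadder P h d 1 2) :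
    ∃ X : Set (MvPolynomial (Fin 2) (ZMod (p ^ α))), X.Finite ∧ S₀ ∈ X ∧
      (∀ S ∈ X, ∀ i, cartierStep P S i ∈ X) ∧
      X.ncard ≤ 1 + (3 * (h + d) + 2 * (α - 1) + 2 * periodBound (3 * (h + d))) *
        p ^ (∑ k ∈ Finset.range α, (region 1 (h * (k + 1)) 1 (d * (k + 1)) (k + 1)).card) +
        p ^ (∑ k ∈ Finset.range α,
          (region 0 (h * (k + 1)) 1 (d * (k + 1) + 1) (k + 1)).card) := by
  classical
  let z : Fin p := ⟨0, hp.out.pos⟩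
  set S₁ := cartierStep P S₀ z with hS₁def
  have hS₁ : S₁ ∈ boxLadder P h d 1 1 :=
    cartierStep_mem_boxLadder hα hP le_rfl le_rfl (Or.inl le_rfl) hS₀
  set f := fun S => cartierStep P S z with hf
  set V := boxLadder P h d 0 1 with hV
  set O := Set.range fun t => f^[t] S₁ with hO
  have hVcard : (V : Set (MvPolynomial (Fin 2) (ZMod (p ^ α)))).Finite ∧ V.carrier.ncard ≤
      p ^ (∑ k ∈ Finset.range α, (region 0 (h * (k + 1)) 1 (d * (k + 1) + 1) (k + 1)).card) := by
    have := card_ladder_le (k := 0) hα hP (Z := fun e => region 0 (h * e + 0) 1 (d * e + 1) e)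
      (fun e m hm n hn => add_mem_region hm hn) (Nat.zero_le _)
    rwa [← Finset.range_eq_Ico] at this
  set W := ladder P (fun e => (region 1 (h * e) 1 (d * e) e : Set (Fin 2 →₀ ℕ))) 0 with hW
  have hWcard : (W : Set (MvPolynomial (Fin 2) (ZMod (p ^ α)))).Finite ∧ W.carrier.ncard ≤
      p ^ (∑ k ∈ Finset.range α, (region 1 (h * (k + 1)) 1 (d * (k + 1)) (k + 1)).card) := by
    have := card_ladder_le (k := 0) hα hP (Z := fun e => region 1 (h * e) 1 (d * e) e)
      (fun e m hm n hn => by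
        have := add_mem_region (a := 0) (b := 0) hm hn
        exact this) (Nat.zero_le _)
    rwa [← Finset.range_eq_Ico] at this
  obtain ⟨N, hN, hface⟩ := exists_face_eventually_periodic hα hP hP0 hS₁ (i := z) rfl
  have hmem (t) : f^[t] S₁ ∈ boxLadder P h d 1 1 := zero_iterate_mem hα hP hS₁ t
  -- Up to an element of `W`, a state on the path is determined by its faces, and these take at most
  -- `N` joint values.
  have hOsub : O ⊆ ⋃ t ∈ Finset.range N, (fun S => S + f^[t] S₁) '' W.carrier := by
    rintro _ ⟨t, rfl⟩
    obtain ⟨t', ht', heq⟩ := hface t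
    refine Set.mem_biUnion (x := t') (by simpa using ht') ⟨f^[t] S₁ - f^[t'] S₁, ?_, by simp⟩
    have h1 := mem_ladder_of_face_eq_zero hα hP
      (Z := fun e => (region 0 (h * e + 1) 1 (d * e + 1) e : Set (Fin 2 →₀ ℕ)))
      (fun e m hm n hn => Finset.mem_coe.2 (add_mem_region (Finset.mem_coe.1 hm) hn)) (edges h d)
      (fun ψ hψ e m hm => newton_subset_faceDomain hψ e (by
        have hm := mem_region.1 (Finset.mem_coe.1 hm)
        simp only [newton, Set.mem_ofPred_eq]
        omega))
      (fun ψ hψ => MvPolynomial.restrictSupport_mono _ (newton_subset_faceDomain hψ _) hP) hP0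
      (Nat.zero_le α) (f^[t] S₁ - f^[t'] S₁) (Submodule.sub_mem _ (hmem t) (hmem t'))
      (fun ψ hψ => by
        have h2 := face_add ψ.1 ψ.2 (p ^ (α - 1)) (f^[t] S₁ - f^[t'] S₁) (f^[t'] S₁)
        rw [sub_add_cancel, heq ψ hψ] at h2
        exact left_eq_add.1 (h2.trans (add_comm _ _)))
    refine ladder_mono (fun e m hm => ?_) h1
    obtain ⟨hm, hψ⟩ := hm
    have hm := mem_region.1 (Finset.mem_coe.1 hm)
    have e1 := hψ (0, 0) (by simp [edges])
    have e2 := hψ (0, h) (by simp [edges])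
    have e3 := hψ (1, d) (by simp [edges])
    simp only [zero_mul] at e1 e2 e3
    exact Finset.mem_coe.2 (mem_region.2 (by omega))
  have hfinU : (⋃ t ∈ Finset.range N, (fun S => S + f^[t] S₁) '' W.carrier).Finite :=
    Set.Finite.biUnion (Finset.finite_toSet _) fun t _ => hWcard.1.image _
  have hOcard : O.ncard ≤ (3 * (h + d) + 2 * (α - 1) + 2 * periodBound (3 * (h + d))) *
      p ^ (∑ k ∈ Finset.range α, (region 1 (h * (k + 1)) 1 (d * (k + 1)) (k + 1)).card) := by
    calc O.ncard ≤ _ := Set.ncard_le_ncard hOsub hfinU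
      _ ≤ ∑ t ∈ Finset.range N, ((fun S => S + f^[t] S₁) '' W.carrier).ncard :=
        Finset.set_ncard_biUnion_le _ _
      _ ≤ ∑ t ∈ Finset.range N, W.carrier.ncard :=
        Finset.sum_le_sum fun t _ => Set.ncard_image_le hWcard.1
      _ = N * W.carrier.ncard := by rw [Finset.sum_const, Finset.card_range, smul_eq_mul]
      _ ≤ _ := Nat.mul_le_mul hN hWcard.2
  have hVle : V ≤ boxLadder P h d 1 2 := boxLadder_mono zero_le_one one_le_two
  have hOle : ∀ S ∈ O, S ∈ boxLadder P h d 1 2 := by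
    rintro _ ⟨t, rfl⟩
    exact boxLadder_mono le_rfl one_le_two (hmem t)
  refine ⟨{S₀} ∪ O ∪ V.carrier, ((Set.finite_singleton _).union (hfinU.subset hOsub)).union
    hVcard.1, Or.inl (Or.inl rfl), ?_, ?_⟩
  · rintro S hS i
    have hall : S ∈ boxLadder P h d 1 2 := by
      rcases hS with (rfl | hS) | hS
      · exact hS₀
      · exact hOle S hS
      · exact hVle hS
    by_cases hi : (i : ℕ) = 0
    · obtain rfl : i = z := Fin.ext hi
      rcases hS with (rfl | ⟨t, rfl⟩) | hS
      · exact Or.inl (Or.inr ⟨0, rfl⟩)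
      · exact Or.inl (Or.inr ⟨t + 1, Function.iterate_succ_apply' f t S₁⟩)
      · exact Or.inr (cartierStep_mem_boxLadder hα hP zero_le_one zero_le_one (Or.inl le_rfl)
          (boxLadder_mono le_rfl one_le_two hS))
    -- A nonzero digit removes the right edge, whatever the state.
    · exact Or.inr (cartierStep_mem_boxLadder hα hP zero_le_one le_rfl (Or.inr hi) hall)
  · refine (Set.ncard_union_le _ _).trans (Nat.add_le_add ?_ hVcard.2)
    refine (Set.ncard_union_le _ _).trans (Nat.add_le_add ?_ hOcard)
    rw [Set.ncard_singleton]

end Orbit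

/-! ### The automaton. -/

section Automaton

lemma exists_dfao_of_finite {p : ℕ} {S B : Type*} (f : S → Fin p → S) (out : S → B) {X : Set S}
    (hX : X.Finite) {s : S} (hs : s ∈ X) (hf : ∀ s ∈ X, ∀ i, f s i ∈ X) :
    ∃ M : DFAO (Fin p) (Fin X.ncard) B, ∀ w, M.eval w = out (w.foldl f s) := by
  have := hX.to_subtype
  have e : X ≃ Fin X.ncard := Finite.equivFinOfCardEq rfl
  refine ⟨⟨fun i a => e ⟨f (e.symm i) a, hf _ (e.symm i).2 a⟩, e ⟨s, hs⟩,
    fun i => out (e.symm i)⟩, fun w => ?_⟩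
  have key : ∀ (w : List (Fin p)) (s : X),
      ((e.symm (w.foldl (fun i a => e ⟨f (e.symm i) a, hf _ (e.symm i).2 a⟩) (e s)) : X) : S) =
        w.foldl f s := by
    intro w
    induction w with
    | nil => simp
    | cons a w ih =>
      intro s
      rw [List.foldl_cons, List.foldl_cons, ih, Equiv.symm_apply_apply]
  exact congrArg out (key w ⟨s, hs⟩)

open MvPolynomial (restrictSupport)

variable {p α h d : ℕ} [hp : Fact p.Prime]

lemma zmod_pow_mul_pow_eq (hα : 1 ≤ α) (c : ZMod (p ^ α)) (t : ℕ) :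
    c ^ (p ^ t * p ^ (α - 1)) = c ^ p ^ (α - 1) := by
  rw [pow_mul]
  refine pow_pow_eq_of_dvd_sub hα ?_
  obtain ⟨b, hb⟩ := (redModP_eq_zero_iff hα (c ^ p ^ t - c)).1
    (by rw [map_sub, map_pow, ZMod.pow_card_pow, sub_self])
  exact ⟨b, hb⟩

/-- After `t` digits the exponent of `P` has become `q - 1 + q * (p ^ t - 1) = p ^ t * q - 1` with
`q = p ^ (α - 1)`, as Furstenberg's formula requires. -/
lemma foldl_cartierStep_eq (hα : 1 ≤ α) {P : MvPolynomial (Fin 2) (ZMod (p ^ α))}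
    {F : PowerSeries (ZMod (p ^ α))} (hF0 : PowerSeries.constantCoeff F = 0)
    (hPF : MvPolynomial.aeval ![PowerSeries.X, F] P = 0) (w : List (Fin p)) :
    (w.foldl (cartierStep P) (P ^ (p ^ (α - 1) - 1) *
      (MvPolynomial.X 1 ^ 2 * MvPolynomial.pderiv 1 P))).coeff (Finsupp.single 1 (p ^ (α - 1))) =
      P.coeff (Finsupp.single 1 1) ^ p ^ (α - 1) *
        PowerSeries.coeff (Nat.ofDigits p (w.map fun i : Fin p => (i : ℕ))) F := by
  have hlt : Nat.ofDigits p (w.map fun i : Fin p => (i : ℕ)) < p ^ w.length := by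
    have := Nat.ofDigits_lt_base_pow_length (l := w.map fun i : Fin p => (i : ℕ)) hp.out.one_lt
      (by simp)
    rwa [List.length_map] at this
  rw [← zmod_pow_mul_pow_eq hα _ w.length, ← coeff_X_sq_mul_pderiv_mul_pow hα hF0 hPF hlt]
  refine (coeff_foldl_cartier (expand_pow_eq hα P) w _ _).trans ?_
  rw [Finsupp.smul_single, smul_eq_mul, add_comm]
  congr 1
  rw [mul_comm (P ^ _), mul_assoc, ← pow_mul, ← pow_add]
  congr 2
  have h1 : 1 ≤ p ^ w.length := Nat.one_le_pow _ _ hp.out.pos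
  have h2 : 1 ≤ p ^ (α - 1) := Nat.one_le_pow _ _ hp.out.pos
  obtain ⟨a, ha⟩ := Nat.exists_eq_add_of_le h1
  obtain ⟨b, hb⟩ := Nat.exists_eq_add_of_le h2
  rw [ha, hb, Nat.add_sub_cancel_left, Nat.add_sub_cancel_left]
  have : (1 + a) * (1 + b) = 1 + (b + (1 + b) * a) := by ring
  omega

lemma X_sq_mul_pderiv_mem {A : Type*} [CommRing A] {P : MvPolynomial (Fin 2) A}
    (hP : P ∈ restrictSupport A (newton h d 1)) :
    MvPolynomial.X 1 ^ 2 * MvPolynomial.pderiv 1 P ∈ restrictSupport A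
      (region 0 (h * 1 + 1) 1 (d * 1 + 2) 1 : Set (Fin 2 →₀ ℕ)) := by
  have h1 : MvPolynomial.X 1 ^ 2 * MvPolynomial.pderiv 1 P = ∑ m ∈ P.support,
      MvPolynomial.X 1 ^ 2 * MvPolynomial.pderiv 1 (MvPolynomial.monomial m (P.coeff m)) := by
    conv_lhs => rw [P.as_sum]
    rw [map_sum, Finset.mul_sum]
  rw [h1]
  refine Submodule.sum_mem _ fun m hm => ?_
  have hm := (MvPolynomial.mem_restrictSupport_iff _).1 hP hm
  simp only [newton, Set.mem_ofPred_eq] at hm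
  rw [MvPolynomial.pderiv_monomial, MvPolynomial.X_pow_eq_monomial, MvPolynomial.monomial_mul,
    one_mul]
  refine (MvPolynomial.monomial_mem_restrictSupport _).2 ?_
  by_cases hm1 : m 1 = 0
  · right
    rw [hm1, Nat.cast_zero, mul_zero]
  · left
    refine Finset.mem_coe.2 (mem_region.2 ?_)
    simp
    omega

/-- An automaton for the coefficients of a power series root over `ℤ/p^α`. -/
theorem exists_dfao_generates (hα : 1 ≤ α) {P : MvPolynomial (Fin 2) (ZMod (p ^ α))}
    {F : PowerSeries (ZMod (p ^ α))} (hF0 : PowerSeries.constantCoeff F = 0)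
    (hPF : MvPolynomial.aeval ![PowerSeries.X, F] P = 0)
    (hP : P ∈ restrictSupport _ (newton h d 1)) (hc : IsUnit (P.coeff (Finsupp.single 1 1)))
    (hP0 : ∀ ψ ∈ edges h d, (face ψ.1 ψ.2 1 P).map (redModP hα) ≠ 0) :
    ∃ k, k ≤ 1 + (3 * (h + d) + 2 * (α - 1) + 2 * periodBound (3 * (h + d))) *
        p ^ (∑ k ∈ Finset.range α, (region 1 (h * (k + 1)) 1 (d * (k + 1)) (k + 1)).card) +
        p ^ (∑ k ∈ Finset.range α,
          (region 0 (h * (k + 1)) 1 (d * (k + 1) + 1) (k + 1)).card) ∧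
      ∃ M : DFAO (Fin p) (Fin k) (ZMod (p ^ α)),
        M.Generates (fun n => PowerSeries.coeff n F) ∧ M.IgnoresLeadingZeros := by
  have hS₀ : P ^ (p ^ (α - 1) - 1) * (MvPolynomial.X 1 ^ 2 * MvPolynomial.pderiv 1 P) ∈
      boxLadder P h d 1 2 := by
    have := mem_ladder_of_le (P := P)
      (Z := fun e => (region 0 (h * e + 1) 1 (d * e + 2) e : Set (Fin 2 →₀ ℕ))) (le_refl 0)
      (X_sq_mul_pderiv_mem hP)
    rwa [pow_zero, one_mul, Nat.sub_zero] at this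
  obtain ⟨X, hX, hS, hstep, hcard⟩ := exists_states hα hP hP0 hS₀
  obtain ⟨u, hu⟩ := (hc.pow (p ^ (α - 1))).exists_left_inv
  obtain ⟨M, hM⟩ := exists_dfao_of_finite (cartierStep P)
    (fun S => u * S.coeff (Finsupp.single 1 (p ^ (α - 1)))) hX hS hstep
  have heval (w) : M.eval w =
      PowerSeries.coeff (Nat.ofDigits p (w.map fun i : Fin p => (i : ℕ))) F := by
    rw [hM, foldl_cartierStep_eq hα hF0 hPF, ← mul_assoc, hu, one_mul]
  refine ⟨X.ncard, hcard, M, fun n w hw => ?_, fun w z hz => ?_⟩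
  · rw [heval]
    congr 1
    have hw' : w.map (fun i : Fin p => (i : ℕ)) = Nat.digits p n := by
      rw [← hw]; simp [List.map_eq_flatMap]
    rw [hw', Nat.ofDigits_digits]
  · rw [heval, heval]
    congr 1
    simp [Nat.ofDigits_append, hz]

end Automaton

/-! ### Exponent sums and the error term. -/

section Estimates

variable {p α h d : ℕ}

lemma sum_card_region_box_le (hh : 1 ≤ h) (hd : 1 ≤ d) :
    ((∑ k ∈ Finset.range α, (region 0 (h * (k + 1)) 1 (d * (k + 1) + 1) (k + 1)).card : ℕ) : ℝ) ≤
      (1 / 6 : ℝ) * α * (α + 1) * ((2 * h * d - 1) * α + h * d + 1) := by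
  induction α with
  | zero => simp
  | succ α ih =>
    have h1 := two_mul_card_region_box (e := α + 1) hh hd
    rw [Nat.add_sub_cancel] at h1
    have h2 : (((region 0 (h * (α + 1)) 1 (d * (α + 1) + 1) (α + 1)).card * 2 +
      (α + 1) * α : ℕ) : ℝ) ≤ ((2 * ((h * (α + 1)) * (d * (α + 1))) : ℕ) : ℝ) := by
        exact_mod_cast h1
    rw [Finset.sum_range_succ]
    push_cast at h2 ih ⊢
    linarith

/-- Without the three edges, level `e` saves `(h + d - 1) * e` points: `(h e - 1)(d e - 1) - (e -
1)(e - 2) / 2 = h d e² - e (e - 1) / 2 - (h + d - 1) e`. -/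
lemma sum_card_region_rem_le (hh : 1 ≤ h) (hd : 1 ≤ d) :
    ((∑ k ∈ Finset.range α, (region 1 (h * (k + 1)) 1 (d * (k + 1)) (k + 1)).card : ℕ) : ℝ) +
      (((h + d - 1) * ∑ k ∈ Finset.range α, (k + 1) : ℕ) : ℝ) ≤
      (1 / 6 : ℝ) * α * (α + 1) * ((2 * h * d - 1) * α + h * d + 1) := by
  induction α with
  | zero => simp
  | succ α ih =>
    have h1 := two_mul_card_region_rem (e := α + 1) hh hd (by omega)
    rw [Nat.add_sub_cancel, show α + 1 - 2 = α - 1 by omega] at h1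
    have h2 : (((region 1 (h * (α + 1)) 1 (d * (α + 1)) (α + 1)).card * 2 +
      α * (α - 1 : ℕ) : ℕ) : ℝ) ≤ ((2 * ((h * (α + 1) - 1) * (d * (α + 1) - 1)) : ℕ) : ℝ) := by
        exact_mod_cast h1
    have h3 : ((h + d - 1 : ℕ) : ℝ) = h + d - 1 := by
      rw [Nat.cast_sub (by omega)]; push_cast; ring
    have h4 : ((h * (α + 1) - 1 : ℕ) : ℝ) = h * (α + 1) - 1 := by
      rw [Nat.cast_sub (Nat.mul_pos hh α.succ_pos)]; push_cast; ring
    have h5 : ((d * (α + 1) - 1 : ℕ) : ℝ) = d * (α + 1) - 1 := by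
      rw [Nat.cast_sub (Nat.mul_pos hd α.succ_pos)]; push_cast; ring
    have h6 : (α : ℝ) * ((α - 1 : ℕ) : ℝ) = α * (α - 1) := by
      cases α with
      | zero => simp
      | succ n => simp
    rw [Finset.sum_range_succ, Finset.sum_range_succ]
    push_cast [h3, h4, h5, h6] at h2 ih ⊢
    linarith

/-- The error term. -/
noncomputable def errorTerm (p α h d : ℕ) : ℝ :=
  -- For `h + d = 1` the denominator would be `1` and the limit in `α` would fail; the theorem needs
  -- only `h, d ≥ 1`.
  if h = 0 ∨ d = 0 then 0 else
    ((3 * (h + d) + 2 * (α - 1) + 2 * periodBound (3 * (h + d)) + 1 : ℕ) : ℝ) /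
      (p : ℝ) ^ ((h + d - 1) * ∑ k ∈ Finset.range α, (k + 1))

lemma le_one_add_errorTerm_mul (hp : 1 ≤ p) (hh : 1 ≤ h) (hd : 1 ≤ d) :
    ((1 + (3 * (h + d) + 2 * (α - 1) + 2 * periodBound (3 * (h + d))) *
        p ^ (∑ k ∈ Finset.range α, (region 1 (h * (k + 1)) 1 (d * (k + 1)) (k + 1)).card) +
        p ^ (∑ k ∈ Finset.range α,
          (region 0 (h * (k + 1)) 1 (d * (k + 1) + 1) (k + 1)).card) : ℕ) : ℝ) ≤
      (1 + errorTerm p α h d) *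
        (p : ℝ) ^ ((1 / 6 : ℝ) * α * (α + 1) * ((2 * h * d - 1) * α + h * d + 1)) := by
  have h1 := sum_card_region_box_le (α := α) hh hd
  have h2 := sum_card_region_rem_le (α := α) hh hd
  have hp0 : (0 : ℝ) < p := by exact_mod_cast hp
  have hp1 : (1 : ℝ) ≤ p := by exact_mod_cast hp
  rw [errorTerm, if_neg (by omega)]
  set x := (1 / 6 : ℝ) * α * (α + 1) * ((2 * h * d - 1) * α + h * d + 1)
  set y := (h + d - 1) * ∑ k ∈ Finset.range α, (k + 1)
  set a := ∑ k ∈ Finset.range α, (region 0 (h * (k + 1)) 1 (d * (k + 1) + 1) (k + 1)).card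
  set b := ∑ k ∈ Finset.range α, (region 1 (h * (k + 1)) 1 (d * (k + 1)) (k + 1)).card
  set K := 3 * (h + d) + 2 * (α - 1) + 2 * periodBound (3 * (h + d))
  have h3 : (p : ℝ) ^ a ≤ (p : ℝ) ^ x := by
    rw [← Real.rpow_natCast]
    exact Real.rpow_le_rpow_of_exponent_le hp1 h1
  have h4 : (p : ℝ) ^ b ≤ (p : ℝ) ^ x / (p : ℝ) ^ y := by
    rw [le_div_iff₀ (pow_pos hp0 _), ← pow_add, ← Real.rpow_natCast]
    refine Real.rpow_le_rpow_of_exponent_le hp1 ?_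
    push_cast at h2 ⊢
    exact h2
  -- Absorbs the initial state; it accounts for the `+ 1` in the numerator of `errorTerm`.
  have h5 : 1 ≤ (p : ℝ) ^ b := one_le_pow₀ hp1
  have h6 : (0 : ℝ) ≤ K := Nat.cast_nonneg _
  have h7 := mul_le_mul_of_nonneg_left h4 h6
  push_cast
  calc _ ≤ (p : ℝ) ^ x / (p : ℝ) ^ y + K * ((p : ℝ) ^ x / (p : ℝ) ^ y) + (p : ℝ) ^ x := by
        linarith
    _ = _ := by ring

end Estimates

/-! ### The error term tends to zero. -/

section Limits

lemma eventually_periodBound_sq_le : ∀ᶠ n in atTop, periodBound (3 * n) ^ 2 ≤ 2 ^ n := by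
  -- For `s = √(6n)` one has `3n + 1 ≤ (s + 1) ^ 2`, so the sixth power of the left side is at most
  -- `(s + 1) ^ (24 s) ≤ 2 ^ (s * s) ≤ 2 ^ (6n)`.
  have h1 : ∀ᶠ s : ℕ in atTop, (s + 1) ^ 24 ≤ 2 ^ s := by
    have h := (tendsto_add_atTop_iff_nat 1).2
      (tendsto_pow_const_div_const_pow_of_one_lt 24 (one_lt_two (α := ℝ)))
    filter_upwards [h.eventually (gt_mem_nhds (show (0 : ℝ) < 1 / 2 by norm_num))] with s hs
    rw [div_lt_iff₀ (by positivity), pow_succ (2 : ℝ)] at hs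
    have : ((s + 1 : ℕ) : ℝ) ^ 24 < 2 ^ s := by linarith
    exact_mod_cast this.le
  have h2 : Tendsto (fun n : ℕ => Nat.sqrt (2 * (3 * n))) atTop atTop := by
    refine tendsto_atTop.2 fun b => ?_
    filter_upwards [eventually_ge_atTop (b * b)] with n hn
    exact Nat.le_sqrt.2 (by omega)
  filter_upwards [h2.eventually h1] with n hn
  rw [periodBound]
  set s := Nat.sqrt (2 * (3 * n)) with hs
  have hs1 : s * s ≤ 6 * n := by have := Nat.sqrt_le (2 * (3 * n)); rw [← hs] at this; omega
  have hs2 : 3 * n + 1 ≤ (s + 1) ^ 2 := by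
    have := Nat.lt_succ_sqrt (2 * (3 * n))
    rw [← hs, Nat.succ_eq_add_one, ← sq] at this
    omega
  refine (Nat.pow_le_pow_iff_left (n := 6) (by norm_num)).1 ?_
  calc _ ≤ ((((s + 1) ^ 2) ^ s) ^ 2) ^ 6 := by gcongr
    _ = ((s + 1) ^ 24) ^ s := by rw [← pow_mul, ← pow_mul, ← pow_mul, ← pow_mul]; congr 1; ring
    _ ≤ (2 ^ s) ^ s := by gcongr
    _ ≤ 2 ^ (6 * n) := by rw [← pow_mul]; exact Nat.pow_le_pow_right two_pos hs1
    _ = _ := by rw [← pow_mul, mul_comm]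

lemma tendsto_periodBound_div : Tendsto (fun n => (periodBound (3 * n) : ℝ) / 2 ^ n) atTop (𝓝 0) := by
  have h1 : Tendsto (fun n : ℕ => √((1 / 2 : ℝ) ^ n)) atTop (𝓝 0) := by
    have := (Real.continuous_sqrt.tendsto 0).comp
      (tendsto_pow_atTop_nhds_zero_of_lt_one (r := (1 / 2 : ℝ)) (by norm_num) (by norm_num))
    rwa [Real.sqrt_zero] at this
  refine squeeze_zero' (Eventually.of_forall fun n => by positivity) ?_ h1
  filter_upwards [eventually_periodBound_sq_le] with n hn
  refine Real.le_sqrt_of_sq_le ?_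
  have : (periodBound (3 * n) : ℝ) ^ 2 ≤ 2 ^ n := by exact_mod_cast hn
  rw [div_pow, one_div, inv_pow, div_le_iff₀ (by positivity), sq ((2 : ℝ) ^ n), inv_mul_cancel_left₀]
  · exact this
  · positivity

lemma errorTerm_nonneg (p α h d : ℕ) : 0 ≤ errorTerm p α h d := by
  unfold errorTerm
  split_ifs
  · exact le_rfl
  · positivity

lemma errorTerm_le_of_le {p α h d b y : ℕ} (hb : 1 ≤ b) (hbp : b ≤ p)
    (hy : 1 ≤ h → 1 ≤ d → y ≤ (h + d - 1) * ∑ k ∈ Finset.range α, (k + 1)) : errorTerm p α h d ≤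
      ((3 * (h + d) + 2 * (α - 1) + 2 * periodBound (3 * (h + d)) + 1 : ℕ) : ℝ) / (b : ℝ) ^ y := by
  unfold errorTerm
  have hb' : (1 : ℝ) ≤ b := by exact_mod_cast hb
  have hbp' : (b : ℝ) ≤ p := by exact_mod_cast hbp
  split_ifs with h0
  · positivity
  · refine div_le_div_of_nonneg_left (by positivity) (by positivity) ?_
    exact (pow_le_pow_right₀ hb' (hy (by omega) (by omega))).trans
      (pow_le_pow_left₀ (by positivity) hbp' _)

lemma le_sum_range_succ (α : ℕ) : α ≤ ∑ k ∈ Finset.range α, (k + 1) := by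
  calc α = ∑ k ∈ Finset.range α, 1 := by simp
    _ ≤ _ := Finset.sum_le_sum fun k _ => by omega

theorem tendsto_errorTerm_prime {α : ℕ} (hα : 1 ≤ α) (h d : ℕ) :
    Tendsto (fun p => errorTerm p α h d) atTop (𝓝 0) := by
  have h1 : Tendsto (fun p : ℕ =>
      ((3 * (h + d) + 2 * (α - 1) + 2 * periodBound (3 * (h + d)) + 1 : ℕ) : ℝ) / (p : ℝ) ^ 1)
      atTop (𝓝 0) := by
    simp only [pow_one]
    exact tendsto_const_div_atTop_nhds_zero_nat _
  refine squeeze_zero' (Eventually.of_forall fun p => errorTerm_nonneg p α h d) ?_ h1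
  filter_upwards [eventually_ge_atTop 1] with p hp
  refine errorTerm_le_of_le hp le_rfl fun hh hd => ?_
  exact Nat.mul_pos (by omega) (hα.trans (le_sum_range_succ α))

theorem tendsto_errorTerm_exponent {p : ℕ} (hp : 2 ≤ p) (h d : ℕ) :
    Tendsto (fun α => errorTerm p α h d) atTop (𝓝 0) := by
  set C := 3 * (h + d) + 2 * periodBound (3 * (h + d)) + 1 with hC
  have h1 : Tendsto (fun α : ℕ => (C : ℝ) * (1 / 2 : ℝ) ^ α + 2 * ((α : ℝ) ^ 1 / 2 ^ α)) atTop
      (𝓝 ((C : ℝ) * 0 + 2 * 0)) :=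
    ((tendsto_pow_atTop_nhds_zero_of_lt_one (r := (1 / 2 : ℝ)) (by norm_num)
      (by norm_num)).const_mul _).add
      ((tendsto_pow_const_div_const_pow_of_one_lt 1 one_lt_two).const_mul _)
  rw [mul_zero, mul_zero, add_zero] at h1
  refine squeeze_zero (fun α => errorTerm_nonneg p α h d) (fun α => ?_) h1
  refine (errorTerm_le_of_le (b := 2) (y := α) one_le_two hp fun hh hd => ?_).trans ?_
  · exact (le_sum_range_succ α).trans (Nat.le_mul_of_pos_left _ (by omega))
  · have h2 : ((3 * (h + d) + 2 * (α - 1) + 2 * periodBound (3 * (h + d)) + 1 : ℕ) : ℝ) ≤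
        C + 2 * α := by
      have : 3 * (h + d) + 2 * (α - 1) + 2 * periodBound (3 * (h + d)) + 1 ≤ C + 2 * α := by omega
      exact_mod_cast this
    calc _ ≤ ((C : ℝ) + 2 * α) / 2 ^ α := by push_cast at h2 ⊢; gcongr
      _ = _ := by rw [one_div, inv_pow]; ring

lemma errorTerm_le_of_sum {p α h d : ℕ} (hp : 2 ≤ p) (hα : 1 ≤ α) : errorTerm p α h d ≤
    ((2 * α + 1 : ℕ) : ℝ) * 2 * (1 / 2) ^ (h + d) + 6 * (((h + d : ℕ) : ℝ) ^ 1 / 2 ^ (h + d)) +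
      4 * ((periodBound (3 * (h + d)) : ℝ) / 2 ^ (h + d)) := by
  refine (errorTerm_le_of_le (b := 2) (y := h + d - 1) one_le_two hp fun hh hd => ?_).trans ?_
  · exact Nat.le_mul_of_pos_right _ (hα.trans (le_sum_range_succ α))
  · have h1 : (1 : ℝ) / 2 ^ (h + d - 1) ≤ 2 / 2 ^ (h + d) := by
      rw [div_le_div_iff₀ (by positivity) (by positivity), one_mul, ← pow_succ']
      exact pow_le_pow_right₀ one_le_two (by omega)
    have h2 : ((3 * (h + d) + 2 * (α - 1) + 2 * periodBound (3 * (h + d)) + 1 : ℕ) : ℝ) ≤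
        ((2 * α + 1 + 3 * (h + d) + 2 * periodBound (3 * (h + d)) : ℕ) : ℝ) := by
      exact_mod_cast (by omega)
    calc _ = ((3 * (h + d) + 2 * (α - 1) + 2 * periodBound (3 * (h + d)) + 1 : ℕ) : ℝ) *
          (1 / 2 ^ (h + d - 1)) := by push_cast; ring
      _ ≤ ((2 * α + 1 + 3 * (h + d) + 2 * periodBound (3 * (h + d)) : ℕ) : ℝ) *
          (2 / 2 ^ (h + d)) := mul_le_mul h2 h1 (by positivity) (by positivity)
      _ = _ := by push_cast; rw [one_div, inv_pow]; ring

lemma tendsto_errorTerm_majorant (α : ℕ) : Tendsto (fun n : ℕ =>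
    ((2 * α + 1 : ℕ) : ℝ) * 2 * (1 / 2) ^ n + 6 * ((n : ℝ) ^ 1 / 2 ^ n) +
      4 * ((periodBound (3 * n) : ℝ) / 2 ^ n)) atTop (𝓝 0) := by
  have := (((tendsto_pow_atTop_nhds_zero_of_lt_one (r := (1 / 2 : ℝ)) (by norm_num)
    (by norm_num)).const_mul (((2 * α + 1 : ℕ) : ℝ) * 2)).add
      ((tendsto_pow_const_div_const_pow_of_one_lt 1 (one_lt_two (α := ℝ))).const_mul 6)).add
        (tendsto_periodBound_div.const_mul 4)
  rwa [mul_zero, mul_zero, mul_zero, add_zero, add_zero] at this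

theorem tendsto_errorTerm_height {p α : ℕ} (hp : 2 ≤ p) (hα : 1 ≤ α) (d : ℕ) :
    Tendsto (fun h => errorTerm p α h d) atTop (𝓝 0) :=
  squeeze_zero (fun h => errorTerm_nonneg p α h d) (fun _ => errorTerm_le_of_sum hp hα)
    ((tendsto_errorTerm_majorant α).comp (tendsto_add_atTop_nat d))

theorem tendsto_errorTerm_degree {p α : ℕ} (hp : 2 ≤ p) (hα : 1 ≤ α) (h : ℕ) :
    Tendsto (fun d => errorTerm p α h d) atTop (𝓝 0) := by
  refine squeeze_zero (fun d => errorTerm_nonneg p α h d) (fun _ => errorTerm_le_of_sum hp hα)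
    ((tendsto_errorTerm_majorant α).comp (f := fun d => h + d) ?_)
  simpa only [add_comm h] using tendsto_add_atTop_nat h

end Limits

/-! ### Reductions of `p`-adic integers. -/

section PadicInt

variable {p α : ℕ} [hp : Fact p.Prime]

lemma redModP_comp_toZModPow (hα : 1 ≤ α) :
    (redModP hα).comp (PadicInt.toZModPow α) = (PadicInt.toZMod : ℤ_[p] →+* ZMod p) := by
  ext x
  have : NeZero (p ^ α) := ⟨pow_ne_zero _ hp.out.ne_zero⟩
  set n := (PadicInt.toZModPow α x).val with hn
  have h1 : x - n ∈ RingHom.ker (PadicInt.toZModPow α : ℤ_[p] →+* ZMod (p ^ α)) := by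
    rw [RingHom.mem_ker, map_sub, map_natCast, hn, ZMod.natCast_zmod_val, sub_self]
  rw [PadicInt.ker_toZModPow, Ideal.mem_span_singleton] at h1
  obtain ⟨y, hy⟩ := h1
  have h2 : PadicInt.toZMod x = (n : ZMod p) := by
    rw [← sub_add_cancel x n, hy, map_add, map_mul, map_pow, map_natCast, map_natCast,
      ZMod.natCast_self, zero_pow (by omega), zero_mul, zero_add]
  rw [h2, RingHom.comp_apply, ← ZMod.natCast_zmod_val (PadicInt.toZModPow α x), map_natCast]

end PadicInt

/-! ### Translation of the hypotheses on `P`. -/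

section Polynomials

open MvPolynomial (restrictSupport)

variable {A : Type*} [CommRing A]

lemma mem_newton_of_degreeOf {P : MvPolynomial (Fin 2) A} {h d : ℕ} (h0 : P.degreeOf 0 ≤ h)
    (h1 : P.degreeOf 1 ≤ d) (hP : P.coeff 0 = 0) : P ∈ restrictSupport A (newton h d 1) := by
  refine mem_restrictSupport_of_coeff fun m hm => ?_
  have hm' := MvPolynomial.mem_support_iff.2 hm
  refine ⟨?_, ?_, ?_⟩
  · rw [mul_one]; exact (MvPolynomial.monomial_le_degreeOf 0 hm').trans h0
  · rw [mul_one]; exact (MvPolynomial.monomial_le_degreeOf 1 hm').trans h1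
  · by_contra hlt
    refine hm ?_
    have : m = 0 := by
      ext i
      fin_cases i <;> simp <;> omega
    rw [this, hP]

lemma eval_zero_zero (P : MvPolynomial (Fin 2) A) :
    MvPolynomial.eval ![0, 0] P = P.coeff 0 := by
  have : (![0, 0] : Fin 2 → A) = 0 := by
    ext i; fin_cases i <;> rfl
  rw [this, ← MvPolynomial.constantCoeff_eq, ← MvPolynomial.eval_zero]

lemma eval_zero_pderiv (P : MvPolynomial (Fin 2) A) :
    MvPolynomial.eval ![0, 0] (MvPolynomial.pderiv 1 P) = P.coeff (Finsupp.single 1 1) := by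
  rw [eval_zero_zero]
  induction P using MvPolynomial.induction_on' with
  | add f g hf hg => rw [map_add, MvPolynomial.coeff_add, MvPolynomial.coeff_add, hf, hg]
  | monomial n r =>
    rw [MvPolynomial.pderiv_monomial, MvPolynomial.coeff_monomial, MvPolynomial.coeff_monomial]
    by_cases h : n = Finsupp.single 1 1
    · simp [h]
    · rw [if_neg h]
      split_ifs with h'
      · have e0 : n 0 = 0 := by simpa using DFunLike.congr_fun h' 0
        have e1 : n 1 - 1 = 0 := by simpa using DFunLike.congr_fun h' 1
        have : n 1 ≠ 1 := fun e => h (by ext i; fin_cases i <;> simp [e0, e])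
        rw [show n 1 = 0 by omega, Nat.cast_zero, mul_zero]
      · rfl

lemma exists_coeff_ne_zero_of_degreeOf {P : MvPolynomial (Fin 2) A} (hP : P ≠ 0) (i : Fin 2) :
    ∃ m, m i = P.degreeOf i ∧ P.coeff m ≠ 0 := by
  classical
  obtain ⟨m, hm, h⟩ := Finset.exists_mem_eq_sup P.support
    (MvPolynomial.support_nonempty.2 hP) (fun m => m i)
  exact ⟨m, by rw [MvPolynomial.degreeOf_eq_sup, h], MvPolynomial.mem_support_iff.1 hm⟩

lemma map_aeval_X_powerSeries {B : Type*} [CommRing B] (f : A →+* B)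
    (P : MvPolynomial (Fin 2) A) (F : PowerSeries A) :
    PowerSeries.map f (MvPolynomial.aeval ![PowerSeries.X, F] P) =
      MvPolynomial.aeval ![PowerSeries.X, PowerSeries.map f F] (MvPolynomial.map f P) := by
  induction P using MvPolynomial.induction_on with
  | C a =>
    rw [MvPolynomial.map_C, ← MvPolynomial.algebraMap_eq, ← MvPolynomial.algebraMap_eq,
      AlgHom.commutes, AlgHom.commutes]
    exact PowerSeries.map_C f a
  | add P Q hP hQ => rw [map_add, map_add, hP, hQ, map_add, map_add]
  | mul_X P i hP =>
    rw [map_mul, map_mul, hP, map_mul, map_mul, MvPolynomial.map_X, MvPolynomial.aeval_X,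
      MvPolynomial.aeval_X]
    fin_cases i <;> simp

variable {p : ℕ} [hp : Fact p.Prime] {P : MvPolynomial (Fin 2) ℤ_[p]} {F : PowerSeries ℤ_[p]}

/-- If `P` did not involve `x`, then `P = y * H(y)` and `F * H(F) = 0` with `F ≠ 0`. The constant
term of `H(F) = 0` would be `∂P/∂y (0, 0) = 0`. -/
lemma IsFurstenbergSeries.degreeOf_zero_ne_zero (hPF : IsFurstenbergSeries P F) (hF : F ≠ 0) :
    P.degreeOf 0 ≠ 0 := by
  intro h0
  have hcoeff (m) (hm : P.coeff m ≠ 0) : m 0 = 0 := by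
    have := MvPolynomial.monomial_le_degreeOf 0 (MvPolynomial.mem_support_iff.2 hm)
    omega
  have hP0 : P.coeff 0 = 0 := by rw [← eval_zero_zero]; exact hPF.eval_zero
  set G := toSeriesPolynomial P with hG
  have hGc (j : ℕ) : G.coeff j = PowerSeries.C (P.coeff (Finsupp.single 1 j)) := by
    ext i
    rw [hG, coeff_coeff_toSeriesPolynomial, PowerSeries.coeff_C]
    split_ifs with hi
    · rw [hi, Finsupp.single_zero, zero_add]
    · by_contra hne
      exact hi (by simpa using hcoeff _ hne)
  have hdvd : (Polynomial.X : Polynomial (PowerSeries ℤ_[p])) ∣ G := by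
    rw [Polynomial.X_dvd_iff, hGc, Finsupp.single_zero, hP0, map_zero]
  obtain ⟨H, hH⟩ := hdvd
  have hroot : F * H.eval F = 0 := by
    rw [← hPF.aeval_eq_zero, ← eval_toSeriesPolynomial, ← hG, hH, Polynomial.eval_mul,
      Polynomial.eval_X]
  have hHF := (mul_eq_zero.1 hroot).resolve_left hF
  refine hPF.pderiv_ne_zero ?_
  have h1 : P.coeff (Finsupp.single 1 1) = 0 := by
    have h2 : H.coeff 0 = PowerSeries.C (P.coeff (Finsupp.single 1 1)) := by
      rw [← hGc, hH, Polynomial.coeff_X_mul]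
    have h3 := congrArg PowerSeries.constantCoeff hHF
    rw [map_zero, ← Polynomial.coe_evalRingHom, Polynomial.coe_evalRingHom,
      Polynomial.eval_eq_sum_range, map_sum, Finset.sum_range_succ'] at h3
    simp only [map_mul, map_pow, hPF.constantCoeff_eq_zero, pow_zero, mul_one, h2,
      PowerSeries.constantCoeff_C] at h3
    simpa using h3
  rw [eval_zero_pderiv, h1, map_zero]

end Polynomials

/-! ### Assembly. -/

theorem theorem1 :
    ∃ ε : ℕ → ℕ → ℕ → ℕ → ℝ,
      (∀ (p : ℕ) [Fact p.Prime] (α h d : ℕ), 1 ≤ α →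
        ∀ (P : MvPolynomial (Fin 2) ℤ_[p]) (F : PowerSeries ℤ_[p]),
          IsFurstenbergSeries P F → F ≠ 0 →
          P.degreeOf 0 = h → (MvPolynomial.map PadicInt.toZMod P).degreeOf 0 = h →
          P.degreeOf 1 = d → (MvPolynomial.map PadicInt.toZMod P).degreeOf 1 = d →
          ∃ k : ℕ,
            IsMinimalAutomatonSize p
              (fun n : ℕ => PadicInt.toZModPow α (PowerSeries.coeff n F)) k ∧
            (k : ℝ) ≤ (1 + ε p α h d) *
              (p : ℝ) ^ ((1 / 6 : ℝ) * α * (α + 1) * ((2 * h * d - 1) * α + h * d + 1))) ∧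
      (∀ α h d : ℕ, 1 ≤ α →
        Tendsto (fun p : ℕ => ε p α h d) (atTop ⊓ 𝓟 {p : ℕ | p.Prime}) (𝓝 0)) ∧
      (∀ p h d : ℕ, p.Prime → Tendsto (fun α : ℕ => ε p α h d) atTop (𝓝 0)) ∧
      (∀ p α d : ℕ, p.Prime → 1 ≤ α → Tendsto (fun h : ℕ => ε p α h d) atTop (𝓝 0)) ∧
      (∀ p α h : ℕ, p.Prime → 1 ≤ α → Tendsto (fun d : ℕ => ε p α h d) atTop (𝓝 0)) := by
  refine ⟨errorTerm, ?_,
    fun α h d hα => (tendsto_errorTerm_prime hα h d).mono_left inf_le_left,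
    fun p h d hp => tendsto_errorTerm_exponent hp.two_le h d,
    fun p α d hp hα => tendsto_errorTerm_height hp.two_le hα d,
    fun p α h hp hα => tendsto_errorTerm_degree hp.two_le hα h⟩
  intro p hp α h d hα P F hPF hF hh hh' hd hd'
  classical
  set P₁ := MvPolynomial.map (PadicInt.toZMod : ℤ_[p] →+* ZMod p) P with hP₁
  set P₂ := MvPolynomial.map (PadicInt.toZModPow α : ℤ_[p] →+* ZMod (p ^ α)) P with hP₂
  set F₂ := PowerSeries.map (PadicInt.toZModPow α : ℤ_[p] →+* ZMod (p ^ α)) F with hF₂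
  have hred (m : Fin 2 →₀ ℕ) : redModP hα (P₂.coeff m) = P₁.coeff m := by
    rw [hP₂, MvPolynomial.coeff_map, hP₁, MvPolynomial.coeff_map, ← redModP_comp_toZModPow hα]
    rfl
  have hc : P₁.coeff (Finsupp.single 1 1) ≠ 0 := by
    rw [hP₁, MvPolynomial.coeff_map, ← eval_zero_pderiv]
    exact hPF.pderiv_ne_zero
  have hP₁0 : P₁ ≠ 0 := by
    intro h0
    rw [h0] at hc
    exact hc rfl
  have hh1 : 1 ≤ h := by
    have := hPF.degreeOf_zero_ne_zero hF
    omega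
  have hd1 : 1 ≤ d := by
    have := MvPolynomial.monomial_le_degreeOf 1 (MvPolynomial.mem_support_iff.2 hc)
    rw [hd'] at this
    simpa using this
  have hP : P₂ ∈ MvPolynomial.restrictSupport _ (newton h d 1) := by
    have h1 : P ∈ MvPolynomial.restrictSupport _ (newton h d 1) :=
      mem_newton_of_degreeOf hh.le hd.le (by rw [← eval_zero_zero, hPF.eval_zero])
    refine mem_restrictSupport_of_coeff fun m hm => ?_
    by_contra hnm
    rw [hP₂, MvPolynomial.coeff_map, coeff_eq_zero_of_mem_restrictSupport h1 hnm, map_zero] at hm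
    exact hm rfl
  have hface (ψ : Fin 2 × ℕ) (m : Fin 2 →₀ ℕ) (hm : m ψ.1 = ψ.2) (hne : P₁.coeff m ≠ 0) :
      (face ψ.1 ψ.2 1 P₂).map (redModP hα) ≠ 0 := by
    intro h0
    have h1 := congrArg (fun g => g.coeff (m (1 - ψ.1))) h0
    simp only [Polynomial.coeff_map, Polynomial.coeff_zero, face, mul_one] at h1
    rw [← hm, ← coeff_eq_coeff_coeff_slice, hred] at h1
    exact hne h1
  -- The left edge contains the monomial `y`; the right and upper edges are nonzero modulo `p`
  -- because reduction preserves both degrees.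
  have hP0 : ∀ ψ ∈ edges h d, (face ψ.1 ψ.2 1 P₂).map (redModP hα) ≠ 0 := by
    intro ψ hψ
    simp only [edges, Finset.mem_insert, Finset.mem_singleton] at hψ
    rcases hψ with rfl | rfl | rfl
    · exact hface _ (Finsupp.single 1 1) (by simp) hc
    · obtain ⟨m, hm, hne⟩ := exists_coeff_ne_zero_of_degreeOf hP₁0 0
      exact hface _ m (hm.trans hh') hne
    · obtain ⟨m, hm, hne⟩ := exists_coeff_ne_zero_of_degreeOf hP₁0 1
      exact hface _ m (hm.trans hd') hne
  have hunit : IsUnit (P₂.coeff (Finsupp.single 1 1)) := by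
    obtain ⟨n, hn⟩ : ∃ n : ℕ, P₂.coeff (Finsupp.single 1 1) = n :=
      ⟨(P₂.coeff (Finsupp.single 1 1)).val, by rw [ZMod.natCast_zmod_val]⟩
    rw [← hred, hn, map_natCast, Ne, ZMod.natCast_eq_zero_iff] at hc
    rw [hn, ZMod.isUnit_iff_coprime]
    exact ((Nat.Prime.coprime_iff_not_dvd hp.out).2 hc).symm.pow_right α
  obtain ⟨k, hk, hM⟩ := exists_dfao_generates hα (F := F₂)
    (by rw [hF₂, ← PowerSeries.coeff_zero_eq_constantCoeff, PowerSeries.coeff_map,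
      PowerSeries.coeff_zero_eq_constantCoeff, hPF.constantCoeff_eq_zero, map_zero])
    (by rw [hP₂, hF₂, ← map_aeval_X_powerSeries, hPF.aeval_eq_zero, map_zero]) hP hunit hP0
  have hF₂' : (fun n => PowerSeries.coeff n F₂) =
      fun n : ℕ => PadicInt.toZModPow α (PowerSeries.coeff n F) := by
    funext n
    rw [hF₂, PowerSeries.coeff_map]
  rw [hF₂'] at hM
  have hex : ∃ m : ℕ, ∃ M : DFAO (Fin p) (Fin m) (ZMod (p ^ α)),
      M.Generates (fun n : ℕ => PadicInt.toZModPow α (PowerSeries.coeff n F)) ∧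
        M.IgnoresLeadingZeros := ⟨k, hM⟩
  refine ⟨Nat.find hex, ⟨Nat.find_spec hex, fun m hm => Nat.find_min' hex hm⟩, ?_⟩
  refine le_trans ?_ (le_one_add_errorTerm_mul hp.out.one_le hh1 hd1)
  exact_mod_cast (Nat.find_min' hex hM).trans hk
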